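/- **Setting.** Write $[x,y]_\theta=xy-\theta(y)x$. A twisted spectral triple $(\mathcal A,H,D)$ consists of a unital complex $*$-algebra $\mathcal A$ with an algebra automorphism $\theta$ (the twisting), a unital $*$-representation of $\mathcal A$ by bounded operators on a complex Hilbert space $H$, and an unbounded self-adjoint operator $D$ on $H$ with compact resolvent, such that for each $a\in\mathcal A$ the operator $[D,a]_\theta=Da-\theta(a)D$ (on $\{v\in\operatorname{dom}D: av\in\operatorname{dom}D\}$) is densely defined and bounded; its bounded extension to $H$ is again denoted $[D,a]_\theta$. Put $\Delta=D^2+1$, regarded as a Laplace operator of order $r=2$, and $H^\infty=\bigcap_n\operatorname{dom}\Delta^n$. For $t\in\mathbb R$, $\mathrm{Op}^t$ is the space of linear maps $T:H^\infty\to H^\infty$ such that for every $s\in\mathbb R$ there is $C$ with $\|\Delta^{(s-t)/r}Tv\|\le C\|\Delta^{s/r}v\|$ for all $v\in H^\infty$; $\mathrm{Op}=\bigcup_t\mathrm{Op}^t$. *Regularity.* $(\mathcal A,H,D)$ is regular if there are an algebra $\mathcal B$ of bounded operators on $H$ containing (the image of) $\mathcal A$ and $[D,\mathcal A]_\theta$,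 and a linear bijection $\theta_{\mathcal B}:\mathcal B\to\mathcal B$ extending $\theta$, such that $\mathcal B$ is invariant under $[|D|,\cdot\,]_{\theta_{\mathcal B}}$, i.e. every $b\in\mathcal B$ maps $\operatorname{dom}|D|$ to itself and $|D|b-\theta_{\mathcal B}(b)|D|$ on $\operatorname{dom}|D|$ is the restriction of an element of $\mathcal B$. *DOs.* A twisted algebra of DOs is an $\mathbb N$-filtered unital algebra $\mathcal D=\bigcup_m\mathcal D^m$ of linear operators on $H^\infty$ with a linear bijection $\theta_{\mathcal D}:\mathcal D\to\mathcal D$ preserving the filtration ($\theta_{\mathcal D}(\mathcal D^m)=\mathcal D^m$), such that $\Delta X-\theta_{\mathcal D}^r(X)\Delta\in\mathcal D^{m+r-1}$ for all $X\in\mathcal D^m$, and for every $X\in\mathcal D^m$ there is $C>0$ with $\|Xv\|\le C\|\Delta^{m/r}v\|$ for all $v\in H^\infty$. It is compatible with $\mathcal A$ if each $a\in\mathcal A$ maps $H^\infty$ to itself and restricts there to an element of $\mathcal D^0$, and $\theta_{\mathcal D}$ extends $\theta$. It contains $[D,\mathcal A]_\theta$ in order $0$ if each $[D,a]_\theta$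 maps $H^\infty$ to itself and restricts to an element of $\mathcal D^0$. Its twisting is diagonalizable with positive spectrum if $\mathcal D$ is the algebraic direct sum of the eigenspaces of $\theta_{\mathcal D}$ and all eigenvalues of $\theta_{\mathcal D}$ are positive real numbers. *$\Psi$DOs.* A twisted algebra of $\Psi$DOs is an $\mathbb R$-filtered unital subalgebra $\Psi=\bigcup_t\Psi^t\subseteq\mathrm{Op}$ with a one-parameter group $(\Theta^z)_{z\in\mathbb C}$ of filtration-preserving algebra automorphisms, such that for all $z\in\mathbb C$, $t\in\mathbb R$: $\Delta^{z/r}\Psi^t\subseteq\Psi^{\mathrm{Re}\,z+t}$ and $\Psi^t\Delta^{z/r}\subseteq\Psi^{\mathrm{Re}\,z+t}$; $\Delta^{z/r}P-\Theta^z(P)\Delta^{z/r}\in\Psi^{\mathrm{Re}\,z+t-1}$ for $P\in\Psi^t$; and $\Psi^0\subseteq\mathrm{Op}^0$. It is compatible with $\mathcal A$ if each $a\in\mathcal A$ restricts to an element of $\Psi^0$ and $\Theta^1(a)-\theta(a)\in\Psi^{-1}$ for all $a\in\mathcal A$. **Theorem.** Let $(\mathcal A,H,D)$ be a twisted spectral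 triple and $\Delta=D^2+1$. 1. If $\mathcal A$ admits a compatible twisted algebra of DOs that contains $[D,\mathcal A]_\theta$ in order $0$ and whose twisting is diagonalizable with positive spectrum, then $(\mathcal A,H,D)$ is regular, and $\mathcal A$ admits a compatible twisted algebra of $\Psi$DOs. 2. Conversely, if $(\mathcal A,H,D)$ is regular, then $\mathcal A$ admits a compatible twisted algebra of DOs that contains $[D,\mathcal A]_\theta$ in order $0$. -/

import Mathlib

open scoped InnerProductSpace

noncomputable section

namespace TwistedNCG

section Operators

variable {H : Type*} [NormedAddCommGroup H] [InnerProductSpace ℂ H]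

/-- Composition `S ∘ T` of unbounded operators on its natural domain
`{v ∈ dom T | T v ∈ dom S}`. -/
def pcomp (S T : H →ₗ.[ℂ] H) : H →ₗ.[ℂ] H where
  domain := (S.domain.comap T.toFun).map T.domain.subtype
  toFun :=
    { toFun := fun v => S
        ⟨T ⟨v.1, by obtain ⟨_, ⟨w, _, rfl⟩⟩ := v; exact w.2⟩,
          by obtain ⟨_, ⟨w, hw, rfl⟩⟩ := v; exact hw⟩
      map_add' := by
        intro v w
        rw [← LinearPMap.map_add]
        congr 1
        apply Subtype.ext
        simp only [Submodule.coe_add]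
        rw [← LinearPMap.map_add]
        rfl
      map_smul' := by
        intro c v
        rw [RingHom.id_apply, ← LinearPMap.map_smul]
        congr 1
        apply Subtype.ext
        simp only [Submodule.coe_smul]
        rw [← LinearPMap.map_smul]
        rfl }

/-- Powers `T ^ n` of an unbounded operator, on their natural domains. -/
def ppow (T : H →ₗ.[ℂ] H) : ℕ → (H →ₗ.[ℂ] H)
  | 0 => LinearMap.id.toPMap ⊤
  | n + 1 => pcomp T (ppow T n)

/-- `T` has compact resolvent: for some `z : ℂ`, the operator `T - z : dom T → H` is a bijection
whose inverse `R` is a compact operator on `H`. -/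
def HasCompactResolvent (T : H →ₗ.[ℂ] H) : Prop :=
  ∃ (z : ℂ) (R : H →L[ℂ] H), IsCompactOperator R ∧
    (∀ w : H, ∃ hw : R w ∈ T.domain, T ⟨R w, hw⟩ - z • R w = w) ∧
    (∀ v : T.domain, R (T v - z • (v : H)) = v)

/-- The eigenspace of the unbounded operator `T` for the real number `x`. -/
def eigSpace (T : H →ₗ.[ℂ] H) (x : ℝ) : Submodule ℂ H :=
  (LinearMap.ker (T.toFun - (x : ℂ) • T.domain.subtype)).map T.domain.subtype

/-- The operator `f(T)` for a self-adjoint operator `T` with compact resolvent.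
Such a `T` is diagonal, `H` being the Hilbert sum of the eigenspaces of `T` for real eigenvalues.
With `P x` the orthogonal projection onto the eigenspace for `x`, the relation below says that
`P x w = f x • P x v` for all `x`; hence `f(T)` has the domain
`{v | ∑ x, ‖f x‖ ^ 2 * ‖P x v‖ ^ 2 < ∞}` and `f(T) v = ∑ x, f x • P x v`. -/
def funCalc (T : H →ₗ.[ℂ] H) (f : ℝ → ℂ) : H →ₗ.[ℂ] H :=
  Submodule.toLinearPMap
    { carrier := {p : H × H | ∀ x : ℝ, ∀ e ∈ eigSpace T x, ⟪e, p.2⟫_ℂ = f x * ⟪e, p.1⟫_ℂ}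
      add_mem' := by
        intro p q hp hq x e he
        simp only [Prod.fst_add, Prod.snd_add, inner_add_right, hp x e he, hq x e he, mul_add]
      zero_mem' := by
        intro x e _
        simp
      smul_mem' := by
        intro c p hp x e he
        simp only [Prod.smul_fst, Prod.smul_snd, inner_smul_right, hp x e he]
        ring }

/-- The absolute value `|T|`. -/
def absOp (T : H →ₗ.[ℂ] H) : H →ₗ.[ℂ] H := funCalc T fun x => ((|x| : ℝ) : ℂ)

/-- The twisted commutator `S b - c S` on its natural domain `{v ∈ dom S | b v ∈ dom S}`.
With `c = θ b` this is `[S, b]_θ`. -/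
def twComm (S : H →ₗ.[ℂ] H) (b c : H →L[ℂ] H) : H →ₗ.[ℂ] H where
  domain := S.domain ⊓ S.domain.comap (b : H →ₗ[ℂ] H)
  toFun :=
    { toFun := fun v => S ⟨b v.1, v.2.2⟩ - c (S ⟨v.1, v.2.1⟩)
      map_add' := by
        intro v w
        have h1 : (⟨b (v + w).1, (v + w).2.2⟩ : S.domain)
            = ⟨b v.1, v.2.2⟩ + ⟨b w.1, w.2.2⟩ := Subtype.ext (map_add b v.1 w.1)
        have h2 : (⟨(v + w).1, (v + w).2.1⟩ : S.domain)
            = ⟨v.1, v.2.1⟩ + ⟨w.1, w.2.1⟩ := rfl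
        rw [h1, h2, LinearPMap.map_add, LinearPMap.map_add, map_add]
        abel
      map_smul' := by
        intro k v
        have h1 : (⟨b (k • v).1, (k • v).2.2⟩ : S.domain)
            = k • ⟨b v.1, v.2.2⟩ := Subtype.ext (map_smul b k v.1)
        have h2 : (⟨(k • v).1, (k • v).2.1⟩ : S.domain) = k • ⟨v.1, v.2.1⟩ := rfl
        rw [h1, h2, LinearPMap.map_smul, LinearPMap.map_smul, map_smul, RingHom.id_apply,
          smul_sub] }

/-- The space `H^∞ = ⋂ n, dom (Δ ^ n)`. -/
def smooth (Δ : H →ₗ.[ℂ] H) : Submodule ℂ H := ⨅ n : ℕ, (ppow Δ n).domain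

/-- The space of linear operators on `H^∞`. -/
abbrev SmoothEnd (Δ : H →ₗ.[ℂ] H) : Type _ := Module.End ℂ (smooth Δ)

open Classical in
/-- The restriction to the subspace `W` of an unbounded operator `S` that is defined on `W` and
maps `W` to itself. (It is only used in that case; otherwise it is `0` by convention.) -/
def restr (W : Submodule ℂ H) (S : H →ₗ.[ℂ] H) : Module.End ℂ W :=
  if h : ∀ v : W, ∃ hv : (v : H) ∈ S.domain, S ⟨v, hv⟩ ∈ W then
    { toFun := fun v => ⟨S ⟨v, (h v).1⟩, (h v).2⟩
      map_add' := by
        intro v w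
        apply Subtype.ext
        exact S.map_add ⟨v, (h v).1⟩ ⟨w, (h w).1⟩
      map_smul' := by
        intro c v
        apply Subtype.ext
        exact S.map_smul c ⟨v, (h v).1⟩ }
  else 0

/-- The operator `Δ` on `H^∞`. -/
def lapOp (Δ : H →ₗ.[ℂ] H) : SmoothEnd Δ := restr (smooth Δ) Δ

/-- The complex power `Δ ^ z` on `H^∞`. -/
def powOp (Δ : H →ₗ.[ℂ] H) (z : ℂ) : SmoothEnd Δ :=
  restr (smooth Δ) (funCalc Δ fun x => (x : ℂ) ^ z)

/-- The norm of the Sobolev space `H^s` on its dense subspace `H^∞`, `Δ` having order `r`: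
`‖v‖_s = ‖Δ ^ (s / r) v‖`. -/
def sobNorm (Δ : H →ₗ.[ℂ] H) (r : ℕ) (s : ℝ) (v : smooth Δ) : ℝ :=
  ‖(powOp Δ ((s : ℂ) / r) v : H)‖

/-- `Op^t`: the operator `T` on `H^∞` has analytic order at most `t`, i.e. for each `s` it extends
to a bounded operator from `H^s` to `H^(s - t)` (the completions of `H^∞` in the Sobolev norms). -/
def IsOp (Δ : H →ₗ.[ℂ] H) (r : ℕ) (t : ℝ) (T : SmoothEnd Δ) : Prop :=
  ∀ s : ℝ, ∃ C : ℝ, ∀ v : smooth Δ, sobNorm Δ r (s - t) (T v) ≤ C * sobNorm Δ r s v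

/-- The operator `X` on `H^∞` is the restriction of the bounded operator `T` on `H`
(so that `T` maps `H^∞` to itself). -/
def Restricts {Δ : H →ₗ.[ℂ] H} (T : H →L[ℂ] H) (X : SmoothEnd Δ) : Prop :=
  ∀ v : smooth Δ, (X v : H) = T v

/-- A twisted algebra of abstract differential operators for the abstract Laplace operator `Δ` of
order `r`: a filtered algebra of operators on `H^∞` with a linear automorphism `θ` of filtered
vector spaces, with the twisted commutator condition and the elliptic estimate. -/
structure TwistedDOAlgebra (Δ : H →ₗ.[ℂ] H) (r : ℕ) where
  carrier : Subalgebra ℂ (SmoothEnd Δ)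
  fil : ℕ → Submodule ℂ (SmoothEnd Δ)
  fil_mono : Monotone fil
  fil_one : 1 ∈ fil 0
  fil_mul : ∀ m n, ∀ X ∈ fil m, ∀ Y ∈ fil n, X * Y ∈ fil (m + n)
  fil_exhaust : ⨆ m, fil m = Subalgebra.toSubmodule carrier
  θ : carrier ≃ₗ[ℂ] carrier
  θ_fil : ∀ m (X : carrier), (θ X : SmoothEnd Δ) ∈ fil m ↔ (X : SmoothEnd Δ) ∈ fil m
  nabla_mem : ∀ m (X : carrier), (X : SmoothEnd Δ) ∈ fil m →
    lapOp Δ * (X : SmoothEnd Δ) - ((θ ^ r) X : SmoothEnd Δ) * lapOp Δ ∈ fil (m + r - 1)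
  elliptic : ∀ m, ∀ X ∈ fil m, ∃ C : ℝ, 0 < C ∧
    ∀ v : smooth Δ, ‖(X v : H)‖ ≤ C * ‖(powOp Δ ((m : ℂ) / r) v : H)‖

/-- A twisted algebra of abstract pseudodifferential operators for the abstract Laplace operator
`Δ` of order `r`: an `ℝ`-filtered subalgebra of `Op` with a complex one-parameter group of
filtration-preserving algebra automorphisms. The stability under complex powers of `Δ` is stated
for the filtered pieces: `Δ^(z/r)` shifts the filtration by `Re z`. -/
structure TwistedPsiDOAlgebra (Δ : H →ₗ.[ℂ] H) (r : ℕ) where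
  carrier : Subalgebra ℂ (SmoothEnd Δ)
  carrier_op : ∀ P ∈ carrier, ∃ t : ℝ, IsOp Δ r t P
  fil : ℝ → Submodule ℂ (SmoothEnd Δ)
  fil_mono : Monotone fil
  fil_one : 1 ∈ fil 0
  fil_mul : ∀ s t, ∀ P ∈ fil s, ∀ Q ∈ fil t, P * Q ∈ fil (s + t)
  fil_exhaust : ⨆ t, fil t = Subalgebra.toSubmodule carrier
  Θ : ℂ → (carrier ≃ₐ[ℂ] carrier)
  Θ_add : ∀ z w (P : carrier), Θ (z + w) P = Θ z (Θ w P)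
  Θ_fil : ∀ z t (P : carrier), (P : SmoothEnd Δ) ∈ fil t → (Θ z P : SmoothEnd Δ) ∈ fil t
  pow_mul_mem : ∀ (z : ℂ) t, ∀ P ∈ fil t, powOp Δ (z / r) * P ∈ fil (z.re + t)
  mul_pow_mem : ∀ (z : ℂ) t, ∀ P ∈ fil t, P * powOp Δ (z / r) ∈ fil (t + z.re)
  comm_mem : ∀ (z : ℂ) t (P : carrier), (P : SmoothEnd Δ) ∈ fil t →
    powOp Δ (z / r) * (P : SmoothEnd Δ) - (Θ z P : SmoothEnd Δ) * powOp Δ (z / r)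
      ∈ fil (z.re + t - 1)
  fil_zero_op : ∀ P ∈ fil 0, IsOp Δ r 0 P

end Operators

section SpectralTriple

/-- A twisted (unital) spectral triple `(A, H, D)` with twisting `θ`. -/
structure TwistedSpectralTriple (A H : Type*) [Ring A] [StarRing A] [Algebra ℂ A] [StarModule ℂ A]
    [NormedAddCommGroup H] [InnerProductSpace ℂ H] [CompleteSpace H] where
  /-- the twisting -/
  θ : A ≃ₐ[ℂ] A
  /-- the representation of `A` on `H` -/
  π : A →⋆ₐ[ℂ] (H →L[ℂ] H)
  D : H →ₗ.[ℂ] H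
  dense_domain : Dense (D.domain : Set H)
  selfAdjoint : IsSelfAdjoint D
  compactResolvent : HasCompactResolvent D
  /-- `[D, a]_θ` is densely defined -/
  comm_dense : ∀ a, Dense ((twComm D (π a) (π (θ a))).domain : Set H)
  /-- `[D, a]_θ` is bounded -/
  comm_bounded : ∀ a, ∃ C : ℝ, ∀ v : (twComm D (π a) (π (θ a))).domain,
    ‖twComm D (π a) (π (θ a)) v‖ ≤ C * ‖(v : H)‖

variable {A H : Type*} [Ring A] [StarRing A] [Algebra ℂ A] [StarModule ℂ A]
  [NormedAddCommGroup H] [InnerProductSpace ℂ H] [CompleteSpace H]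

namespace TwistedSpectralTriple

variable (S : TwistedSpectralTriple A H)

/-- The abstract Laplace operator `Δ = D ^ 2 + 1`, of order `2`. -/
def lap : H →ₗ.[ℂ] H := (LinearMap.id : H →ₗ[ℂ] H) +ᵥ pcomp S.D S.D

/-- `T` is the bounded operator `[D, a]_θ` on `H`, the unique bounded extension of the densely
defined twisted commutator. -/
def IsComm (a : A) (T : H →L[ℂ] H) : Prop :=
  ∀ v : (twComm S.D (S.π a) (S.π (S.θ a))).domain, T v = twComm S.D (S.π a) (S.π (S.θ a)) v

/-- Regularity: there are an algebra `B` of bounded operators on `H` that contains `A` and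
`[D, A]_θ` and a linear automorphism `σ` of `B` that extends `θ`, such that `B` is invariant under
`[|D|, · ]_σ`: each `b ∈ B` maps `dom |D|` to itself, and `|D| b - σ(b) |D|`, defined on `dom |D|`,
is the restriction of an element of `B`. -/
def IsRegular : Prop :=
  ∃ (B : Subalgebra ℂ (H →L[ℂ] H)) (σ : B ≃ₗ[ℂ] B),
    (∀ a, ∃ b : B, (b : H →L[ℂ] H) = S.π a ∧ (σ b : H →L[ℂ] H) = S.π (S.θ a)) ∧
    (∀ a T, S.IsComm a T → T ∈ B) ∧
    ∀ b : B, ∃ c ∈ B,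
      (twComm (absOp S.D) (b : H →L[ℂ] H) (σ b : H →L[ℂ] H)).domain = (absOp S.D).domain ∧
      ∀ v, twComm (absOp S.D) (b : H →L[ℂ] H) (σ b : H →L[ℂ] H) v = c v

end TwistedSpectralTriple

namespace TwistedDOAlgebra

variable {S : TwistedSpectralTriple A H} (𝓓 : TwistedDOAlgebra S.lap 2)

/-- `𝓓` is compatible with `A`: `A ⊆ 𝓓^0` as operators on `H^∞`, and the twisting of `𝓓` extends
that of `A`. -/
def Compatible : Prop :=
  ∀ a : A, ∃ X : 𝓓.carrier, (X : SmoothEnd S.lap) ∈ 𝓓.fil 0 ∧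
    Restricts (S.π a) (X : SmoothEnd S.lap) ∧
    Restricts (S.π (S.θ a)) (𝓓.θ X : SmoothEnd S.lap)

/-- `𝓓` contains `[D, A]_θ` in order `0`. -/
def ContainsComm : Prop :=
  ∀ (a : A) (T : H →L[ℂ] H), S.IsComm a T → ∃ X ∈ 𝓓.fil 0, Restricts T X

/-- The twisting of `𝓓` as a linear map from `𝓓` to itself. -/
def twist : Module.End ℂ 𝓓.carrier := 𝓓.θ.toLinearMap

/-- The twisting of `𝓓` is diagonalizable: `𝓓` is the algebraic direct sum of the eigenspaces. -/
def Diagonalizable : Prop :=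
  DirectSum.IsInternal fun μ : ℂ => Module.End.eigenspace (R := ℂ) (M := 𝓓.carrier) 𝓓.twist μ

/-- All eigenvalues of the twisting of `𝓓` are positive real numbers. -/
def PositiveSpectrum : Prop :=
  ∀ μ : ℂ, Module.End.HasEigenvalue (R := ℂ) (M := 𝓓.carrier) 𝓓.twist μ →
    ∃ t : ℝ, 0 < t ∧ μ = t

end TwistedDOAlgebra

/-- `Ψ` is compatible with `A`: `A ⊆ Ψ^0` as operators on `H^∞`, and `Θ^1(a) - θ(a) ∈ Ψ^(-1)` for
all `a ∈ A`. -/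
def TwistedPsiDOAlgebra.Compatible {S : TwistedSpectralTriple A H}
    (Ψ : TwistedPsiDOAlgebra S.lap 2) : Prop :=
  ∀ a : A, ∃ P Q : Ψ.carrier,
    (P : SmoothEnd S.lap) ∈ Ψ.fil 0 ∧ Restricts (S.π a) (P : SmoothEnd S.lap) ∧
    Restricts (S.π (S.θ a)) (Q : SmoothEnd S.lap) ∧
    (Ψ.Θ 1 P : SmoothEnd S.lap) - (Q : SmoothEnd S.lap) ∈ Ψ.fil (-1)

end SpectralTriple

end TwistedNCG

end

open TwistedNCG

/-!
Everything is diagonal. A self-adjoint operator `D` with compact resolvent has a Hilbert basis of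
eigenvectors (`exists_hilbertBasis_isDiag`), in which `Δ = D² + 1`, its powers and `|D|` multiply
the coordinates by functions of the eigenvalues. Write `Λ = Δ ^ (1 / 2)`, and `Op` for the algebra
of all operators of finite analytic order on `H^∞`.

Both regularity and the existence of the algebras of operators are reduced to one notion
(`OpTwisting`): the elements of `A` and `[D, A]_θ` have order zero, and there is a linear
automorphism `σ` of `Op` that extends `θ` and agrees with conjugation by `Λ` up to order `-1`; then
`Λ T - σ(T) Λ` has order zero for every `T`. Given `σ`, the full algebra `Op` serves as a witness
for every existence claim: filtered by its integral orders it is a twisted algebra of differential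
operators with twisting `σ`, since `σ²` agrees with conjugation by `Δ` up to order `-1`; with
conjugation by the complex powers of `Δ` it is a twisted algebra of pseudodifferential operators;
and the bounded operators that restrict to `Op^0` form the algebra `B` required for regularity
(`OpTwisting.isRegular`), since `Λ - |D|` is bounded and commutes with `Δ`. To find `σ` it is enough
to have a twisting `τ` on some subspace of `Op^0` with `Λ X - τ(X) Λ` of order zero: `τ` then agrees
with conjugation by `Λ` up to order `-1`, and linear algebra extends it to all of `Op`
(`exists_linearEquiv_extend`).

Such a subspace is `𝓓^0` in one direction. Elements of `𝓓^m` have order at most `m`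
(`TwistedDOAlgebra.isOp_of_mem_fil`): the elliptic estimate bounds `X` from `H^m` to `H`, the
relation `Δ X = θ²(X) Δ + Y` moves this up and down the Sobolev scale in steps of two, and the three
lines theorem fills the gaps. If `θ(X) = μ X` with `μ > 0`, then `Z = Λ X - μ X Λ` satisfies the
Lyapunov equation `Λ Z + μ Z Λ = Δ X - μ² X Δ`, whose right-hand side has order `m + 1` only. In
matrix coefficients `Z` arises from it by division by `l i + μ * l j`, where the `l i` are the
eigenvalues of `Λ`, and `√(l i) * √(μ * l j) / (l i + μ * l j)` is a bounded Schur multiplier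
(`re_sum_le_of_schur`). So `Z` has order `m`. Diagonalizability reduces the general `X` to this
case.

In the other direction the subspace is the algebra `B` of regularity, restricted to `H^∞`. Iterating
`|D| b = σ(b) |D| + c` shows that `B` preserves the domains of all powers of `|D|`, hence `H^∞`, and
that it acts boundedly on the Sobolev spaces of integral order, for the negative orders because the
twisting of `B` is onto (`AbsCommutes.isOp_restrict`).
-/

noncomputable section

namespace TwistedNCG

/-! ### Self-adjoint operators with compact resolvent are diagonal -/

section Spectral

variable {H : Type*} [NormedAddCommGroup H] [InnerProductSpace ℂ H]

lemma mem_eigSpace {T : H →ₗ.[ℂ] H} {x : ℝ} {e : H} :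
    e ∈ eigSpace T x ↔ (e, (x : ℂ) • e) ∈ T.graph := by
  simp only [eigSpace, Submodule.mem_map, LinearMap.mem_ker, LinearPMap.mem_graph_iff,
    LinearMap.sub_apply, LinearMap.smul_apply, Submodule.subtype_apply, sub_eq_zero]
  constructor
  · rintro ⟨y, h, rfl⟩
    exact ⟨y, rfl, h⟩
  · rintro ⟨y, rfl, h⟩
    exact ⟨y, h, rfl⟩

variable [CompleteSpace H]

lemma inner_symm_of_isSelfAdjoint {D : H →ₗ.[ℂ] H} (hD : IsSelfAdjoint D) {v v' w w' : H}
    (hv : (v, v') ∈ D.graph) (hw : (w, w') ∈ D.graph) : ⟪v', w⟫_ℂ = ⟪v, w'⟫_ℂ := by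
  have hadj : D.adjoint = D := LinearPMap.isSelfAdjoint_def.mp hD
  have h := LinearPMap.adjoint_isFormalAdjoint hD.dense_domain
  rw [hadj] at h
  rw [LinearPMap.mem_graph_iff] at hv hw
  obtain ⟨a, ha, rfl⟩ := hv
  obtain ⟨c, hc, rfl⟩ := hw
  obtain rfl : (a : H) = v := ha
  obtain rfl : (c : H) = w := hc
  exact h a c

lemma mem_graph_of_isSelfAdjoint {D : H →ₗ.[ℂ] H} (hD : IsSelfAdjoint D) {v w : H}
    (h : ∀ u u' : H, (u, u') ∈ D.graph → ⟪w, u⟫_ℂ = ⟪v, u'⟫_ℂ) : (v, w) ∈ D.graph := by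
  have hadj : D.adjoint = D := LinearPMap.isSelfAdjoint_def.mp hD
  have h' : ∀ x : D.domain, ⟪w, x⟫_ℂ = ⟪v, D x⟫_ℂ := fun x => h _ _ (D.mem_graph x)
  have hv : v ∈ D.adjoint.domain := LinearPMap.mem_adjoint_domain_of_exists v ⟨w, h'⟩
  have hw := LinearPMap.adjoint_apply_eq hD.dense_domain ⟨v, hv⟩ h'
  have := D.adjoint.mem_graph ⟨v, hv⟩
  rw [hw] at this
  exact hadj ▸ this

/-- The eigenspaces of a self-adjoint operator with compact resolvent span a dense subspace.
The compact self-adjoint operator `K = R† R`, with `R` the resolvent, has finite-dimensional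
eigenspaces, which `R` preserves since it is normal; an eigenvector of `R` is one of `D`. -/
lemma orthogonal_iSup_eigSpace {D : H →ₗ.[ℂ] H} (hD : IsSelfAdjoint D)
    (hc : HasCompactResolvent D) : (⨆ x : ℝ, eigSpace D x)ᗮ = ⊥ := by
  obtain ⟨z, R, hRc, hR1, hR2⟩ := hc
  have hR1' : ∀ w, (R w, w + z • R w) ∈ D.graph := by
    intro w
    obtain ⟨hw, h⟩ := hR1 w
    rw [← sub_eq_iff_eq_add.mp h]
    exact D.mem_graph ⟨R w, hw⟩
  have hR2' : ∀ v v', (v, v') ∈ D.graph → R v' = v + z • R v := by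
    intro v v' h
    rw [LinearPMap.mem_graph_iff] at h
    obtain ⟨y, rfl, rfl⟩ := h
    have := hR2 y
    rw [map_sub, map_smul, sub_eq_iff_eq_add] at this
    exact this
  set Rd : H →L[ℂ] H := ContinuousLinearMap.adjoint R with hRd
  set zb : ℂ := starRingEnd ℂ z with hzb
  have hRd1 : ∀ u, (Rd u, u + zb • Rd u) ∈ D.graph := by
    intro u
    refine mem_graph_of_isSelfAdjoint hD fun v v' hv => ?_
    rw [hRd, ContinuousLinearMap.adjoint_inner_left, hR2' v v' hv, inner_add_left,
      inner_smul_left, ContinuousLinearMap.adjoint_inner_left, inner_add_right, inner_smul_right,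
      hzb, Complex.conj_conj]
  have hRd2 : ∀ v v', (v, v') ∈ D.graph → Rd v' = v + zb • Rd v := by
    intro v v' h
    refine ext_inner_right ℂ fun w => ?_
    rw [hRd, ContinuousLinearMap.adjoint_inner_left, inner_symm_of_isSelfAdjoint hD h (hR1' w),
      inner_add_left, inner_smul_left, ContinuousLinearMap.adjoint_inner_left, inner_add_right,
      inner_smul_right, hzb, Complex.conj_conj]
  -- The resolvent identity shows that `R` is normal.
  have id1 : ∀ u, Rd u = R u + (zb - z) • R (Rd u) := by
    intro u
    have := hR2' _ _ (hRd1 u)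
    rw [map_add, map_smul] at this
    rw [sub_smul, ← add_sub_assoc, this]
    abel
  have id2 : ∀ u, R u = Rd u + (z - zb) • Rd (R u) := by
    intro u
    have := hRd2 _ _ (hR1' u)
    rw [map_add, map_smul] at this
    rw [sub_smul, ← add_sub_assoc, this]
    abel
  have hnormal : ∀ u, R (Rd u) = Rd (R u) := by
    intro u
    by_cases hz : zb = z
    · have hR : ∀ u, Rd u = R u := fun u => by simpa [hz] using id1 u
      simp only [hR]
    · have h := id1 u
      rw [id2 u] at h
      have h2 : (zb - z) • R (Rd u) = (zb - z) • Rd (R u) := by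
        have h3 : (z - zb) • Rd (R u) + (zb - z) • R (Rd u) = 0 := by
          rw [add_assoc] at h
          exact left_eq_add.mp h
        rw [← neg_sub z zb, neg_smul, neg_smul] at *
        rw [add_neg_eq_zero] at h3
        rw [h3]
      exact smul_right_injective H (sub_ne_zero.mpr hz) h2
  set K : H →L[ℂ] H := Rd ∘L R with hK
  have hKc : IsCompactOperator K := hRc.clm_comp Rd
  have hKs : K.IsSymmetric := by
    intro u v
    simp only [hK, hRd, ContinuousLinearMap.coe_coe, ContinuousLinearMap.comp_apply,
      ContinuousLinearMap.adjoint_inner_left, ContinuousLinearMap.adjoint_inner_right]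
  have hKR : ∀ u, K (R u) = R (K u) := fun u => by
    simp only [hK, ContinuousLinearMap.comp_apply, hnormal]
  have hRinj : ∀ u, R u = 0 → u = 0 := by
    intro u hu
    have := hR1' u
    rw [hu, smul_zero, add_zero] at this
    exact LinearPMap.graph_fst_eq_zero_snd D this rfl
  have hspec := ContinuousLinearMap.orthogonalComplement_iSup_eigenspaces_eq_bot hKc hKs
  -- The resolvent and its adjoint act on eigenvectors of `D` by `(x - z)⁻¹` and `(x - zb)⁻¹`, so
  -- `R` preserves the orthogonal complement of the span `M` of the eigenvectors.
  set M : Submodule ℂ H := ⨆ x : ℝ, eigSpace D x with hM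
  have hMperp : ∀ w, w ∈ Mᗮ ↔ ∀ x : ℝ, ∀ e ∈ eigSpace D x, ⟪e, w⟫_ℂ = 0 := by
    intro w
    rw [hM, ← Submodule.iInf_orthogonal, Submodule.mem_iInf]
    exact Iff.rfl
  have hRe : ∀ x : ℝ, ∀ e ∈ eigSpace D x, ((x : ℂ) - z) • R e = e := by
    intro x e he
    have := hR2' _ _ (mem_eigSpace.mp he)
    rw [map_smul] at this
    rw [sub_smul, this, add_sub_cancel_right]
  have hRde : ∀ x : ℝ, ∀ e ∈ eigSpace D x, ((x : ℂ) - zb) • Rd e = e := by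
    intro x e he
    have := hRd2 _ _ (mem_eigSpace.mp he)
    rw [map_smul] at this
    rw [sub_smul, this, add_sub_cancel_right]
  have hRM : ∀ w ∈ Mᗮ, R w ∈ Mᗮ := by
    intro w hw
    rw [hMperp] at hw ⊢
    intro x e he
    by_cases h0 : (x : ℂ) - zb = 0
    · have := hRde x e he
      rw [h0, zero_smul] at this
      rw [← this, inner_zero_left]
    · rw [← ContinuousLinearMap.adjoint_inner_left]
      have h1 : Rd e = ((x : ℂ) - zb)⁻¹ • e := by
        rw [eq_inv_smul_iff₀ h0]
        exact hRde x e he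
      rw [← hRd, h1, inner_smul_left, hw x e he, mul_zero]
  have hKe : ∀ x : ℝ, ∀ e ∈ eigSpace D x, ∃ κ : ℂ, K e = κ • e := by
    intro x e he
    by_cases h0 : (x : ℂ) - z = 0
    · have := hRe x e he
      rw [h0, zero_smul] at this
      exact ⟨0, by rw [← this]; simp⟩
    by_cases h0' : (x : ℂ) - zb = 0
    · have := hRde x e he
      rw [h0', zero_smul] at this
      exact ⟨0, by rw [← this]; simp⟩
    · refine ⟨((x : ℂ) - z)⁻¹ * ((x : ℂ) - zb)⁻¹, ?_⟩
      have h1 : Rd e = ((x : ℂ) - zb)⁻¹ • e := by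
        rw [eq_inv_smul_iff₀ h0']
        exact hRde x e he
      have h2 : R e = ((x : ℂ) - z)⁻¹ • e := by
        rw [eq_inv_smul_iff₀ h0]
        exact hRe x e he
      rw [hK, ContinuousLinearMap.comp_apply, h2, map_smul, h1, smul_smul]
  rw [Submodule.eq_bot_iff]
  intro v hv
  suffices h : v ∈ (⨆ κ : ℂ, Module.End.eigenspace (K : Module.End ℂ H) κ)ᗮ by
    rw [hspec] at h
    exact h
  rw [← Submodule.iInf_orthogonal, Submodule.mem_iInf]
  intro κ
  -- `K` is injective, so only the finite-dimensional eigenspaces matter.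
  by_cases hκ : κ = 0
  · intro k hk
    rw [hκ, Module.End.mem_eigenspace_iff, zero_smul] at hk
    have h1 : ⟪k, K k⟫_ℂ = 0 := by
      have : K k = 0 := hk
      rw [this, inner_zero_right]
    rw [hK, ContinuousLinearMap.comp_apply, hRd, ContinuousLinearMap.adjoint_inner_right,
      inner_self_eq_zero] at h1
    rw [hRinj k h1, inner_zero_left]
  set E : Submodule ℂ H := Module.End.eigenspace (K : Module.End ℂ H) κ with hE
  have : FiniteDimensional ℂ E := ContinuousLinearMap.finite_dimensional_eigenspace hKc κ hκ
  have hmemE : ∀ u, u ∈ E ↔ K u = κ • u := fun u => Module.End.mem_eigenspace_iff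
  have hEorth : ∀ κ' : ℂ, κ' ≠ κ → ∀ e u : H, K e = κ' • e → u ∈ E → ⟪e, u⟫_ℂ = 0 := by
    intro κ' hne e u he hu
    exact hKs.orthogonalFamily_eigenspaces hne ⟨e, Module.End.mem_eigenspace_iff.mpr he⟩ ⟨u, hu⟩
  rw [← Submodule.starProjection_apply_eq_zero_iff]
  set p : H := E.starProjection v with hp
  have hpE : p ∈ E := Submodule.starProjection_apply_mem E v
  have hpM : p ∈ Mᗮ := by
    rw [hMperp] at hv ⊢
    intro x e he
    obtain ⟨κ', hκ'⟩ := hKe x e he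
    by_cases hne : κ' = κ
    · have heE : e ∈ E := (hmemE e).mpr (hne ▸ hκ')
      rw [hp, ← Submodule.inner_starProjection_left_eq_right,
        Submodule.starProjection_eq_self_iff.mpr heE]
      exact hv x e he
    · exact hEorth κ' hne e p hκ' hpE
  -- If the component `p` in the eigenspace `E` of `K` of a vector of `Mᗮ` is not zero, then `R` has
  -- an eigenvector in `E ⊓ Mᗮ`. This is an eigenvector of `D` orthogonal to itself.
  by_contra hp0
  set F : Submodule ℂ H := E ⊓ Mᗮ with hF
  have hRF : ∀ u ∈ F, (R : H →ₗ[ℂ] H) u ∈ F := by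
    rintro u ⟨hu1, hu2⟩
    refine ⟨(hmemE _).mpr ?_, hRM u hu2⟩
    rw [ContinuousLinearMap.coe_coe, hKR, (hmemE u).mp hu1, map_smul]
  have : FiniteDimensional ℂ F := Submodule.finiteDimensional_inf_left E Mᗮ
  have : Nontrivial F := ⟨⟨⟨p, hpE, hpM⟩, 0, fun h => hp0 (congrArg Subtype.val h)⟩⟩
  obtain ⟨ρ, hρ⟩ := Module.End.exists_eigenvalue ((R : H →ₗ[ℂ] H).restrict hRF)
  obtain ⟨f, hf⟩ := hρ.exists_hasEigenvector
  have hf0 : (f : H) ≠ 0 := fun h => hf.2 (Subtype.ext h)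
  have hfR : R (f : H) = ρ • (f : H) := congrArg Subtype.val hf.apply_eq_smul
  have hρ0 : ρ ≠ 0 := by
    rintro rfl
    rw [zero_smul] at hfR
    exact hf0 (hRinj _ hfR)
  have hfD : ((f : H), (ρ⁻¹ + z) • (f : H)) ∈ D.graph := by
    have h := D.graph.smul_mem ρ⁻¹ (hR1' f)
    rw [hfR, Prod.smul_mk, smul_smul, inv_mul_cancel₀ hρ0, one_smul, smul_add, smul_smul, smul_smul,
      mul_right_comm, inv_mul_cancel₀ hρ0, one_mul, ← add_smul] at h
    exact h
  have hreal : starRingEnd ℂ (ρ⁻¹ + z) = ρ⁻¹ + z := by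
    have h := inner_symm_of_isSelfAdjoint hD hfD hfD
    rw [inner_smul_left, inner_smul_right] at h
    exact mul_right_cancel₀ (inner_self_ne_zero.mpr hf0) h
  obtain ⟨x, hx⟩ := Complex.conj_eq_iff_real.mp hreal
  rw [hx] at hfD
  exact hf0 (inner_self_eq_zero.mp ((hMperp f).mp f.2.2 x f (mem_eigSpace.mpr hfD)))

end Spectral

/-! ### Diagonal unbounded operators -/

section Diag

variable {H : Type*} [NormedAddCommGroup H] [InnerProductSpace ℂ H] {ι : Type*}

/-- The unbounded operator `T` is diagonal in the Hilbert basis `b`, with eigenvalues `t`, and has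
the maximal domain: `T v = w` means that the coordinates of `w` are those of `v` multiplied
by `t`. -/
def IsDiag (b : HilbertBasis ι ℂ H) (T : H →ₗ.[ℂ] H) (t : ι → ℂ) : Prop :=
  ∀ v w : H, (v, w) ∈ T.graph ↔ ∀ i, ⟪b i, w⟫_ℂ = t i * ⟪b i, v⟫_ℂ

lemma ext_coord (b : HilbertBasis ι ℂ H) {v w : H} (h : ∀ i, ⟪b i, v⟫_ℂ = ⟪b i, w⟫_ℂ) :
    v = w := by
  apply b.repr.injective
  ext i
  rw [b.repr_apply_apply, b.repr_apply_apply, h i]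

lemma hasSum_normSq_coord (b : HilbertBasis ι ℂ H) (v : H) :
    HasSum (fun i => ‖⟪b i, v⟫_ℂ‖ ^ 2) (‖v‖ ^ 2) := by
  have h := lp.hasSum_norm (p := 2) (by norm_num) (b.repr v)
  simpa [b.repr_apply_apply] using h

lemma exists_coord (b : HilbertBasis ι ℂ H) {c : ι → ℂ} (hc : Summable fun i => ‖c i‖ ^ 2) :
    ∃ w : H, ∀ i, ⟪b i, w⟫_ℂ = c i := by
  have hm : Memℓp c 2 := memℓp_gen (by simpa using hc)
  refine ⟨b.repr.symm ⟨c, hm⟩, fun i => ?_⟩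
  rw [← b.repr_apply_apply, LinearIsometryEquiv.apply_symm_apply]

lemma norm_le_of_coord (b : HilbertBasis ι ℂ H) {v w : H}
    (h : ∀ i, ‖⟪b i, v⟫_ℂ‖ ≤ ‖⟪b i, w⟫_ℂ‖) : ‖v‖ ≤ ‖w‖ := by
  have := hasSum_le (fun i => pow_le_pow_left₀ (norm_nonneg _) (h i) 2)
    (hasSum_normSq_coord b v) (hasSum_normSq_coord b w)
  exact (sq_le_sq₀ (norm_nonneg v) (norm_nonneg w)).mp this

lemma exists_coord_of_le (b : HilbertBasis ι ℂ H) {c : ι → ℂ} {v w : H}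
    (h : ∀ i, ‖c i‖ ≤ ‖⟪b i, v⟫_ℂ‖ + ‖⟪b i, w⟫_ℂ‖) : ∃ u : H, ∀ i, ⟪b i, u⟫_ℂ = c i := by
  apply exists_coord b
  have hs := ((hasSum_normSq_coord b v).summable.add (hasSum_normSq_coord b w).summable).mul_left 2
  refine Summable.of_nonneg_of_le (fun i => sq_nonneg _) (fun i => ?_) hs
  have h1 := pow_le_pow_left₀ (norm_nonneg _) (h i) 2
  nlinarith [sq_nonneg (‖⟪b i, v⟫_ℂ‖ - ‖⟪b i, w⟫_ℂ‖)]

lemma coord_self (b : HilbertBasis ι ℂ H) [DecidableEq ι] (i j : ι) :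
    ⟪b i, b j⟫_ℂ = if i = j then 1 else 0 :=
  orthonormal_iff_ite.mp b.orthonormal i j

lemma IsDiag.domain_iff {b : HilbertBasis ι ℂ H} {T : H →ₗ.[ℂ] H} {t : ι → ℂ} (h : IsDiag b T t)
    {v : H} : v ∈ T.domain ↔ ∃ w : H, ∀ i, ⟪b i, w⟫_ℂ = t i * ⟪b i, v⟫_ℂ := by
  rw [LinearPMap.mem_domain_iff]
  exact exists_congr fun w => h v w

lemma IsDiag.apply {b : HilbertBasis ι ℂ H} {T : H →ₗ.[ℂ] H} {t : ι → ℂ} (h : IsDiag b T t)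
    (v : T.domain) (i : ι) : ⟪b i, T v⟫_ℂ = t i * ⟪b i, (v : H)⟫_ℂ :=
  (h v (T v)).mp (T.mem_graph v) i

lemma IsDiag.coord_eigSpace {b : HilbertBasis ι ℂ H} {T : H →ₗ.[ℂ] H} {x : ι → ℝ}
    (h : IsDiag b T fun i => (x i : ℂ)) {y : ℝ} {e : H} (he : e ∈ eigSpace T y) {i : ι}
    (hi : x i ≠ y) : ⟪b i, e⟫_ℂ = 0 := by
  have h1 := (h _ _).mp (mem_eigSpace.mp he) i
  rw [inner_smul_right] at h1
  have h2 : ((y : ℂ) - x i) * ⟪b i, e⟫_ℂ = 0 := by rw [sub_mul, h1, sub_self]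
  refine (mul_eq_zero.mp h2).resolve_left (sub_ne_zero.mpr ?_)
  exact_mod_cast hi.symm

lemma IsDiag.basis_mem_eigSpace {b : HilbertBasis ι ℂ H} {T : H →ₗ.[ℂ] H} {x : ι → ℝ}
    (h : IsDiag b T fun i => (x i : ℂ)) (i : ι) : b i ∈ eigSpace T (x i) := by
  classical
  rw [mem_eigSpace, h]
  intro j
  rw [inner_smul_right, coord_self]
  split_ifs with hij
  · rw [hij]
  · simp

/-- The functional calculus multiplies the coordinates by `f` of the eigenvalues. -/
lemma IsDiag.funCalc {b : HilbertBasis ι ℂ H} {T : H →ₗ.[ℂ] H} {x : ι → ℝ}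
    (h : IsDiag b T fun i => (x i : ℂ)) (f : ℝ → ℂ) :
    IsDiag b (funCalc T f) fun i => f (x i) := by
  have key : ∀ v w : H, (∀ y : ℝ, ∀ e ∈ eigSpace T y, ⟪e, w⟫_ℂ = f y * ⟪e, v⟫_ℂ) ↔
      ∀ i, ⟪b i, w⟫_ℂ = f (x i) * ⟪b i, v⟫_ℂ := by
    intro v w
    refine ⟨fun hvw i => hvw _ _ (h.basis_mem_eigSpace i), fun hvw y e he => ?_⟩
    rw [← b.tsum_inner_mul_inner e w, ← b.tsum_inner_mul_inner e v, ← tsum_mul_left]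
    refine tsum_congr fun i => ?_
    by_cases hi : x i = y
    · rw [hvw i, hi]
      ring
    · rw [← inner_conj_symm, h.coord_eigSpace he hi]
      simp
  intro v w
  rw [TwistedNCG.funCalc, Submodule.toLinearPMap_graph_eq]
  · exact key v w
  · rintro ⟨v, w⟩ hp hv
    obtain rfl : v = 0 := hv
    refine ext_coord b fun i => ?_
    have := (key 0 w).mp hp i
    simpa using this

/-- The natural domain of a composite is the maximal one when a bound on `S T v` controls `T v`. -/
lemma IsDiag.pcomp {b : HilbertBasis ι ℂ H} {S T : H →ₗ.[ℂ] H} {s t : ι → ℂ}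
    (hS : IsDiag b S s) (hT : IsDiag b T t) (hst : ∀ i, ‖t i‖ ≤ 1 + ‖s i * t i‖) :
    IsDiag b (pcomp S T) fun i => s i * t i := by
  have hgraph : ∀ v w : H, (v, w) ∈ (TwistedNCG.pcomp S T).graph ↔
      ∃ u, (v, u) ∈ T.graph ∧ (u, w) ∈ S.graph := by
    intro v w
    simp only [LinearPMap.mem_graph_iff]
    constructor
    · rintro ⟨⟨_, ⟨y, hy, rfl⟩⟩, rfl, rfl⟩
      exact ⟨T y, ⟨y, rfl, rfl⟩, ⟨⟨T y, hy⟩, rfl, rfl⟩⟩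
    · rintro ⟨u, ⟨y, rfl, rfl⟩, ⟨z, hz, rfl⟩⟩
      obtain ⟨z, hz'⟩ := z
      obtain rfl : z = T y := hz
      exact ⟨⟨y, ⟨y, hz', rfl⟩⟩, rfl, rfl⟩
  intro v w
  rw [hgraph]
  constructor
  · rintro ⟨u, hu, hw⟩ i
    rw [(hS _ _).mp hw i, (hT _ _).mp hu i, mul_assoc]
  · intro hw
    obtain ⟨u, hu⟩ := exists_coord_of_le b (c := fun i => t i * ⟪b i, v⟫_ℂ) (v := v) (w := w) <| by
      intro i
      rw [hw i, norm_mul, norm_mul (s i * t i)]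
      calc ‖t i‖ * ‖⟪b i, v⟫_ℂ‖ ≤ (1 + ‖s i * t i‖) * ‖⟪b i, v⟫_ℂ‖ := by gcongr; exact hst i
        _ = _ := by ring
    refine ⟨u, (hT _ _).mpr hu, (hS _ _).mpr fun i => ?_⟩
    rw [hw i, hu i, mul_assoc]

lemma IsDiag.id_vadd {b : HilbertBasis ι ℂ H} {T : H →ₗ.[ℂ] H} {t : ι → ℂ} (h : IsDiag b T t) :
    IsDiag b ((LinearMap.id : H →ₗ[ℂ] H) +ᵥ T) fun i => t i + 1 := by
  have hgraph : ∀ v w : H, (v, w) ∈ ((LinearMap.id : H →ₗ[ℂ] H) +ᵥ T).graph ↔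
      (v, w - v) ∈ T.graph := by
    intro v w
    simp only [LinearPMap.mem_graph_iff]
    constructor
    · rintro ⟨y, rfl, rfl⟩
      exact ⟨y, rfl, by rw [LinearPMap.vadd_apply]; simp⟩
    · rintro ⟨y, rfl, hy⟩
      exact ⟨y, rfl, by rw [LinearPMap.vadd_apply]; simp [hy]⟩
  intro v w
  rw [hgraph, h]
  refine forall_congr' fun i => ?_
  rw [inner_sub_right, sub_eq_iff_eq_add, add_mul, one_mul]

lemma IsDiag.ppow {b : HilbertBasis ι ℂ H} {T : H →ₗ.[ℂ] H} {t : ι → ℂ} (h : IsDiag b T t)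
    (ht : ∀ i, 1 ≤ ‖t i‖) (n : ℕ) : IsDiag b (ppow T n) fun i => t i ^ n := by
  induction n with
  | zero =>
    intro v w
    simp only [TwistedNCG.ppow, LinearPMap.mem_graph_iff, pow_zero, one_mul]
    constructor
    · rintro ⟨y, rfl, rfl⟩ i
      rfl
    · intro hvw
      exact ⟨⟨v, trivial⟩, rfl, (ext_coord b hvw).symm⟩
  | succ n ih =>
    have := h.pcomp ih fun i => ?_
    · simp only [pow_succ']
      exact this
    · rw [norm_mul]
      nlinarith [ht i, norm_nonneg (t i ^ n)]

lemma orthogonalFamily_eigSpace [CompleteSpace H] {D : H →ₗ.[ℂ] H} (hD : IsSelfAdjoint D) :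
    OrthogonalFamily ℂ (fun x : ℝ => eigSpace D x) fun x => (eigSpace D x).subtypeₗᵢ := by
  intro x y hxy e f
  have h := inner_symm_of_isSelfAdjoint hD (mem_eigSpace.mp e.2) (mem_eigSpace.mp f.2)
  rw [inner_smul_left, inner_smul_right, Complex.conj_ofReal] at h
  have h2 : ((x : ℂ) - y) * ⟪(e : H), (f : H)⟫_ℂ = 0 := by rw [sub_mul, h, sub_self]
  refine (mul_eq_zero.mp h2).resolve_left (sub_ne_zero.mpr ?_)
  exact_mod_cast hxy

lemma completeSpace_eigSpace [CompleteSpace H] {D : H →ₗ.[ℂ] H} (hD : IsSelfAdjoint D) (x : ℝ) :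
    CompleteSpace (eigSpace D x) := by
  have hcl : IsClosed (eigSpace D x : Set H) := by
    have : (eigSpace D x : Set H) = (fun e => (e, (x : ℂ) • e)) ⁻¹' (D.graph : Set (H × H)) := by
      ext e
      exact mem_eigSpace
    rw [this]
    exact IsClosed.preimage (by fun_prop) hD.isClosed
  exact hcl.completeSpace_coe

lemma isDiag_of_isSelfAdjoint [CompleteSpace H] {D : H →ₗ.[ℂ] H} (hD : IsSelfAdjoint D)
    (b : HilbertBasis ι ℂ H) (x : ι → ℝ) (hb : ∀ i, b i ∈ eigSpace D (x i)) :
    IsDiag b D fun i => (x i : ℂ) := by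
  intro v v'
  constructor
  · intro h i
    have := inner_symm_of_isSelfAdjoint hD (mem_eigSpace.mp (hb i)) h
    rw [inner_smul_left, Complex.conj_ofReal] at this
    exact this.symm
  · intro h
    refine mem_graph_of_isSelfAdjoint hD fun u u' hu => ?_
    rw [← b.tsum_inner_mul_inner v' u, ← b.tsum_inner_mul_inner v u']
    refine tsum_congr fun i => ?_
    have h1 := inner_symm_of_isSelfAdjoint hD (mem_eigSpace.mp (hb i)) hu
    rw [inner_smul_left, Complex.conj_ofReal] at h1
    rw [← inner_conj_symm v', h i, ← inner_conj_symm v, ← h1, map_mul, Complex.conj_ofReal]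
    ring

/-- The spectral theorem for self-adjoint operators with compact resolvent. -/
theorem exists_hilbertBasis_isDiag.{u} {H : Type u} [NormedAddCommGroup H] [InnerProductSpace ℂ H]
    [CompleteSpace H] {D : H →ₗ.[ℂ] H} (hD : IsSelfAdjoint D) (hc : HasCompactResolvent D) :
    ∃ (κ : Type u) (b : HilbertBasis κ ℂ H) (x : κ → ℝ), IsDiag b D fun i => (x i : ℂ) := by
  have hcomp := completeSpace_eigSpace hD
  choose s bs hbs using fun x : ℝ => exists_hilbertBasis ℂ (eigSpace D x)
  have hon := (orthogonalFamily_eigSpace hD).orthonormal_sigma_orthonormal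
    fun x => (bs x).orthonormal
  have hspan : (Submodule.span ℂ (Set.range fun a : Σ x, s x =>
      (eigSpace D a.1).subtypeₗᵢ (bs a.1 a.2)))ᗮ = ⊥ := by
    rw [Submodule.eq_bot_iff]
    intro v hv
    suffices h : v ∈ (⨆ x : ℝ, eigSpace D x)ᗮ by
      rw [orthogonal_iSup_eigSpace hD hc] at h
      exact h
    rw [← Submodule.iInf_orthogonal, Submodule.mem_iInf]
    intro x
    rw [← Submodule.starProjection_apply_eq_zero_iff]
    suffices h : (eigSpace D x).orthogonalProjectionOnto v = 0 by
      rw [Submodule.starProjection_apply, h, Submodule.coe_zero]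
    refine ext_coord (bs x) fun i => ?_
    rw [inner_zero_right, Submodule.inner_orthogonalProjectionOnto_eq_of_mem_left]
    exact hv _ (Submodule.subset_span ⟨⟨x, i⟩, rfl⟩)
  refine ⟨_, HilbertBasis.mkOfOrthogonalEqBot hon hspan, fun a => a.1,
    isDiag_of_isSelfAdjoint hD _ _ fun a => ?_⟩
  rw [HilbertBasis.coe_mkOfOrthogonalEqBot]
  exact (bs a.1 a.2).2

end Diag

/-! ### The space `H^∞` in coordinates -/

section Smooth

variable {H : Type*} [NormedAddCommGroup H] [InnerProductSpace ℂ H] {ι : Type*}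

/-- The operator `Δ` is diagonal in the Hilbert basis `b`, with eigenvalues `lam i ≥ 1`. -/
structure LapDiag (b : HilbertBasis ι ℂ H) (Δ : H →ₗ.[ℂ] H) (lam : ι → ℝ) : Prop where
  diag : IsDiag b Δ fun i => (lam i : ℂ)
  one_le : ∀ i, 1 ≤ lam i

/-- The power `Λ ^ z = Δ ^ (z / 2)` of the operator `Λ` of order one, acting on `H^∞`. -/
abbrev sobPow (Δ : H →ₗ.[ℂ] H) (z : ℂ) : SmoothEnd Δ := powOp Δ (z / (2 : ℕ))

namespace LapDiag

variable {b : HilbertBasis ι ℂ H} {Δ : H →ₗ.[ℂ] H} {lam : ι → ℝ}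

lemma pos (h : LapDiag b Δ lam) (i : ι) : 0 < lam i := zero_lt_one.trans_le (h.one_le i)

lemma ofReal_ne_zero (h : LapDiag b Δ lam) (i : ι) : (lam i : ℂ) ≠ 0 :=
  Complex.ofReal_ne_zero.mpr (h.pos i).ne'

lemma mem_smooth (h : LapDiag b Δ lam) {v : H} :
    v ∈ smooth Δ ↔ ∀ n : ℕ, ∃ w : H, ∀ i, ⟪b i, w⟫_ℂ = (lam i : ℂ) ^ n * ⟪b i, v⟫_ℂ := by
  have hn : ∀ n, IsDiag b (ppow Δ n) fun i => (lam i : ℂ) ^ n := h.diag.ppow fun i => by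
    rw [Complex.norm_real, Real.norm_of_nonneg (h.pos i).le]
    exact h.one_le i
  rw [smooth, Submodule.mem_iInf]
  exact forall_congr' fun n => (hn n).domain_iff

/-- Multiplication of the coordinates by a sequence of polynomial growth preserves `H^∞`. -/
lemma mem_smooth_of_coord (h : LapDiag b Δ lam) {c : ι → ℂ} {C : ℝ} {n : ℕ}
    (hc : ∀ i, ‖c i‖ ≤ C * lam i ^ n) (v : smooth Δ) {w : H}
    (hw : ∀ i, ⟪b i, w⟫_ℂ = c i * ⟪b i, (v : H)⟫_ℂ) : w ∈ smooth Δ := by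
  rw [h.mem_smooth]
  intro m
  obtain ⟨u, hu⟩ := h.mem_smooth.mp v.2 (m + n)
  refine exists_coord_of_le b (v := (C : ℂ) • u) (w := 0) fun i => ?_
  have hl := (h.pos i).le
  rw [hw, inner_smul_right, hu, inner_zero_right, norm_zero, add_zero, norm_mul, norm_mul, norm_mul,
    norm_mul, norm_pow, norm_pow, Complex.norm_real, Complex.norm_real, Real.norm_of_nonneg hl,
    pow_add]
  calc lam i ^ m * (‖c i‖ * ‖⟪b i, (v : H)⟫_ℂ‖)
      ≤ lam i ^ m * ((|C| * lam i ^ n) * ‖⟪b i, (v : H)⟫_ℂ‖) := by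
        gcongr
        exact (hc i).trans (by gcongr; exact le_abs_self C)
    _ = _ := by rw [Real.norm_eq_abs]; ring

lemma exists_coord_smooth (h : LapDiag b Δ lam) {c : ι → ℂ} {C : ℝ} {n : ℕ}
    (hc : ∀ i, ‖c i‖ ≤ C * lam i ^ n) (v : smooth Δ) :
    ∃ w ∈ smooth Δ, ∀ i, ⟪b i, w⟫_ℂ = c i * ⟪b i, (v : H)⟫_ℂ := by
  obtain ⟨u, hu⟩ := h.mem_smooth.mp v.2 n
  obtain ⟨w, hw⟩ := exists_coord_of_le b (c := fun i => c i * ⟪b i, (v : H)⟫_ℂ)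
    (v := (C : ℂ) • u) (w := 0) fun i => by
      have hl := (h.pos i).le
      rw [inner_smul_right, hu, inner_zero_right, norm_zero, add_zero, norm_mul, norm_mul, norm_mul,
        norm_pow, Complex.norm_real, Complex.norm_real, Real.norm_of_nonneg hl, ← mul_assoc]
      gcongr
      exact (hc i).trans (by gcongr; exact le_abs_self C)
  exact ⟨w, h.mem_smooth_of_coord hc v hw, hw⟩

lemma restr_coord (h : LapDiag b Δ lam) {T : H →ₗ.[ℂ] H} {t : ι → ℂ} (hT : IsDiag b T t)
    {C : ℝ} {n : ℕ} (ht : ∀ i, ‖t i‖ ≤ C * lam i ^ n) (v : smooth Δ) (i : ι) :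
    ⟪b i, (restr (smooth Δ) T v : H)⟫_ℂ = t i * ⟪b i, (v : H)⟫_ℂ := by
  have hdom : ∀ v : smooth Δ, ∃ hv : (v : H) ∈ T.domain, T ⟨v, hv⟩ ∈ smooth Δ := by
    intro v
    obtain ⟨w, -, hw⟩ := h.exists_coord_smooth ht v
    have hv := hT.domain_iff.mpr ⟨w, hw⟩
    exact ⟨hv, h.mem_smooth_of_coord ht v fun i => hT.apply ⟨v, hv⟩ i⟩
  rw [restr, dif_pos hdom]
  exact hT.apply ⟨v, (hdom v).1⟩ i

lemma powOp_coord (h : LapDiag b Δ lam) (z : ℂ) (v : smooth Δ) (i : ι) :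
    ⟪b i, (powOp Δ z v : H)⟫_ℂ = (lam i : ℂ) ^ z * ⟪b i, (v : H)⟫_ℂ := by
  refine h.restr_coord (C := 1) (n := ⌈z.re⌉₊) (h.diag.funCalc fun x => (x : ℂ) ^ z) (fun i => ?_)
    v i
  rw [Complex.norm_cpow_eq_rpow_re_of_pos (h.pos i), one_mul, ← Real.rpow_natCast]
  exact Real.rpow_le_rpow_of_exponent_le (h.one_le i) (Nat.le_ceil _)

lemma lapOp_coord (h : LapDiag b Δ lam) (v : smooth Δ) (i : ι) :
    ⟪b i, (lapOp Δ v : H)⟫_ℂ = (lam i : ℂ) * ⟪b i, (v : H)⟫_ℂ := by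
  refine h.restr_coord (C := 1) (n := 1) h.diag (fun i => ?_) v i
  rw [Complex.norm_real, Real.norm_of_nonneg (h.pos i).le, one_mul, pow_one]

lemma smooth_ext (_ : LapDiag b Δ lam) {v w : smooth Δ}
    (hvw : ∀ i, ⟪b i, (v : H)⟫_ℂ = ⟪b i, (w : H)⟫_ℂ) : v = w :=
  Subtype.ext (ext_coord b hvw)

lemma sobPow_add (h : LapDiag b Δ lam) (z w : ℂ) :
    sobPow Δ (z + w) = sobPow Δ z * sobPow Δ w := by
  refine LinearMap.ext fun v => h.smooth_ext fun i => ?_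
  rw [Module.End.mul_apply, h.powOp_coord, h.powOp_coord, h.powOp_coord, add_div,
    Complex.cpow_add _ _ (h.ofReal_ne_zero i), mul_assoc]

lemma sobPow_zero (h : LapDiag b Δ lam) : sobPow Δ 0 = 1 := by
  refine LinearMap.ext fun v => h.smooth_ext fun i => ?_
  rw [h.powOp_coord, zero_div, Complex.cpow_zero, one_mul, Module.End.one_apply]

lemma sobPow_two (h : LapDiag b Δ lam) : sobPow Δ 2 = lapOp Δ := by
  refine LinearMap.ext fun v => h.smooth_ext fun i => ?_
  rw [h.powOp_coord, h.lapOp_coord, Nat.cast_ofNat, div_self two_ne_zero, Complex.cpow_one]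

lemma sobPow_one_mul_self (h : LapDiag b Δ lam) : sobPow Δ 1 * sobPow Δ 1 = lapOp Δ := by
  rw [← h.sobPow_add, one_add_one_eq_two, h.sobPow_two]

lemma sobPow_mul_neg (h : LapDiag b Δ lam) (z : ℂ) : sobPow Δ z * sobPow Δ (-z) = 1 := by
  rw [← h.sobPow_add, add_neg_cancel, h.sobPow_zero]

lemma sobPow_neg_mul (h : LapDiag b Δ lam) (z : ℂ) : sobPow Δ (-z) * sobPow Δ z = 1 := by
  rw [← h.sobPow_add, neg_add_cancel, h.sobPow_zero]

lemma sobNorm_eq (s : ℝ) (v : smooth Δ) : sobNorm Δ 2 s v = ‖(sobPow Δ (s : ℂ) v : H)‖ := rfl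

lemma sobNorm_zero (h : LapDiag b Δ lam) (v : smooth Δ) : sobNorm Δ 2 0 v = ‖(v : H)‖ := by
  rw [sobNorm_eq, Complex.ofReal_zero, h.sobPow_zero, Module.End.one_apply]

lemma norm_sobPow_coord (h : LapDiag b Δ lam) (z : ℂ) (v : smooth Δ) (i : ι) :
    ‖⟪b i, (sobPow Δ z v : H)⟫_ℂ‖ = lam i ^ (z.re / 2) * ‖⟪b i, (v : H)⟫_ℂ‖ := by
  rw [h.powOp_coord, norm_mul, Complex.norm_cpow_eq_rpow_re_of_pos (h.pos i),
    Complex.div_natCast_re, Nat.cast_ofNat]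

lemma norm_sobPow (h : LapDiag b Δ lam) (z : ℂ) (v : smooth Δ) :
    ‖(sobPow Δ z v : H)‖ = sobNorm Δ 2 z.re v := by
  rw [sobNorm_eq]
  apply le_antisymm <;> refine norm_le_of_coord b fun i => ?_ <;>
    rw [h.norm_sobPow_coord, h.norm_sobPow_coord, Complex.ofReal_re]

lemma sobNorm_mono (h : LapDiag b Δ lam) {s t : ℝ} (hst : s ≤ t) (v : smooth Δ) :
    sobNorm Δ 2 s v ≤ sobNorm Δ 2 t v := by
  refine norm_le_of_coord b fun i => ?_
  erw [h.norm_sobPow_coord, h.norm_sobPow_coord]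
  rw [Complex.ofReal_re, Complex.ofReal_re]
  gcongr
  exact h.one_le i

lemma sobNorm_sobPow (h : LapDiag b Δ lam) (s : ℝ) (z : ℂ) (v : smooth Δ) :
    sobNorm Δ 2 s (sobPow Δ z v) = sobNorm Δ 2 (s + z.re) v := by
  rw [sobNorm_eq, ← Module.End.mul_apply, ← h.sobPow_add, h.norm_sobPow, Complex.add_re,
    Complex.ofReal_re]

/-- The `i`-th vector of the Hilbert basis, as an element of `H^∞`. -/
def basisVec (h : LapDiag b Δ lam) (i : ι) : smooth Δ :=
  ⟨b i, by
    classical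
    rw [h.mem_smooth]
    intro n
    refine ⟨(lam i : ℂ) ^ n • b i, fun j => ?_⟩
    rw [inner_smul_right, coord_self]
    split_ifs with hij
    · rw [hij]
    · simp⟩

/-- The vector of `H^∞` with coordinates `c i` for `i ∈ F` and `0` otherwise. -/
def finVec (h : LapDiag b Δ lam) (F : Finset ι) (c : ι → ℂ) : smooth Δ :=
  ∑ i ∈ F, c i • h.basisVec i

lemma coe_finVec (h : LapDiag b Δ lam) (F : Finset ι) (c : ι → ℂ) :
    (h.finVec F c : H) = ∑ i ∈ F, c i • b i := by
  simp only [finVec, AddSubmonoidClass.coe_finsetSum, Submodule.coe_smul]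
  rfl

lemma normSq_finVec (h : LapDiag b Δ lam) (F : Finset ι) (c : ι → ℂ) :
    ‖(h.finVec F c : H)‖ ^ 2 = ∑ i ∈ F, ‖c i‖ ^ 2 := by
  have h1 := b.orthonormal.inner_sum c c F
  rw [← h.coe_finVec, inner_self_eq_norm_sq_to_K] at h1
  simp only [RCLike.conj_mul] at h1
  exact_mod_cast h1

lemma sobPow_finVec (h : LapDiag b Δ lam) (z : ℂ) (F : Finset ι) (c : ι → ℂ) :
    sobPow Δ z (h.finVec F c) = h.finVec F fun i => (lam i : ℂ) ^ (z / (2 : ℕ)) * c i := by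
  classical
  simp only [finVec, map_sum, map_smul]
  refine Finset.sum_congr rfl fun i _ => ?_
  rw [mul_comm, ← smul_smul]
  congr 1
  refine h.smooth_ext fun j => ?_
  rw [h.powOp_coord, Submodule.coe_smul, inner_smul_right]
  change _ * ⟪b j, b i⟫_ℂ = _ * ⟪b j, b i⟫_ℂ
  rw [coord_self]
  split_ifs with hij
  · rw [hij]
  · simp

lemma inner_finVec (h : LapDiag b Δ lam) (F : Finset ι) (c : ι → ℂ) (v : H) :
    ⟪(h.finVec F c : H), v⟫_ℂ = ∑ i ∈ F, starRingEnd ℂ (c i) * ⟪b i, v⟫_ℂ := by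
  rw [coe_finVec, sum_inner]
  simp only [inner_smul_left]

/-- The truncation of a vector of `H` to finitely many coordinates. -/
def trunc (h : LapDiag b Δ lam) (F : Finset ι) (v : H) : smooth Δ := h.finVec F fun i => ⟪b i, v⟫_ℂ

lemma coord_trunc (h : LapDiag b Δ lam) [DecidableEq ι] (F : Finset ι) (v : H) (i : ι) :
    ⟪b i, (h.trunc F v : H)⟫_ℂ = if i ∈ F then ⟪b i, v⟫_ℂ else 0 := by
  rw [trunc, coe_finVec, inner_sum]
  simp only [inner_smul_right, coord_self, mul_ite, mul_one, mul_zero]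
  rw [Finset.sum_ite_eq F i]

lemma tendsto_trunc (h : LapDiag b Δ lam) (v : H) :
    Filter.Tendsto (fun F => (h.trunc F v : H)) Filter.atTop (nhds v) := by
  have := b.hasSum_repr v
  simp only [b.repr_apply_apply] at this
  simp only [trunc, coe_finVec]
  exact this

lemma sobPow_trunc (h : LapDiag b Δ lam) (z : ℂ) (F : Finset ι) (v : smooth Δ) :
    sobPow Δ z (h.trunc F v) = h.trunc F (sobPow Δ z v) := by
  rw [trunc, trunc, sobPow_finVec]
  simp only [h.powOp_coord]

lemma tendsto_sobNorm_sub_trunc (h : LapDiag b Δ lam) (s : ℝ) (v : smooth Δ) :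
    Filter.Tendsto (fun F => sobNorm Δ 2 s (h.trunc F v - v)) Filter.atTop (nhds 0) := by
  have h1 := (h.tendsto_trunc (sobPow Δ s v : H)).sub_const (sobPow Δ s v : H)
  rw [sub_self] at h1
  have h2 := h1.norm
  rw [norm_zero] at h2
  refine h2.congr fun F => ?_
  rw [sobNorm_eq, map_sub, sobPow_trunc, Submodule.coe_sub]

lemma dense_smooth (h : LapDiag b Δ lam) : Dense (smooth Δ : Set H) := fun v =>
  mem_closure_of_tendsto (h.tendsto_trunc v) (Filter.Eventually.of_forall fun F => (h.trunc F v).2)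

end LapDiag

end Smooth

/-! ### Operators between Sobolev spaces: density and interpolation -/

section Sobolev

variable {H : Type*} [NormedAddCommGroup H] [InnerProductSpace ℂ H] {ι : Type*}

/-- The operator `T` on `H^∞` is bounded from the Sobolev norm of order `s` to that of
order `t`. -/
def MapsSob (Δ : H →ₗ.[ℂ] H) (s t : ℝ) (T : SmoothEnd Δ) : Prop :=
  ∃ C : ℝ, ∀ v : smooth Δ, sobNorm Δ 2 t (T v) ≤ C * sobNorm Δ 2 s v

variable {b : HilbertBasis ι ℂ H} {Δ : H →ₗ.[ℂ] H} {lam : ι → ℝ}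

namespace MapsSob

variable {s t r : ℝ} {T U : SmoothEnd Δ}

lemma exists_pos (hT : MapsSob Δ s t T) :
    ∃ C : ℝ, 0 < C ∧ ∀ v : smooth Δ, sobNorm Δ 2 t (T v) ≤ C * sobNorm Δ 2 s v := by
  obtain ⟨C, hC⟩ := hT
  refine ⟨|C| + 1, by positivity, fun v => (hC v).trans ?_⟩
  gcongr
  · exact norm_nonneg _
  · exact (le_abs_self C).trans (by linarith)

lemma zero : MapsSob Δ s t (0 : SmoothEnd Δ) :=
  ⟨0, fun v => by simp [sobNorm]⟩

lemma add (hT : MapsSob Δ s t T) (hU : MapsSob Δ s t U) : MapsSob Δ s t (T + U) := by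
  obtain ⟨C, hC⟩ := hT
  obtain ⟨C', hC'⟩ := hU
  refine ⟨C + C', fun v => ?_⟩
  have : sobNorm Δ 2 t ((T + U) v) ≤ sobNorm Δ 2 t (T v) + sobNorm Δ 2 t (U v) := by
    simp only [sobNorm, LinearMap.add_apply, map_add, Submodule.coe_add]
    exact norm_add_le _ _
  linarith [hC v, hC' v]

lemma smul (c : ℂ) (hT : MapsSob Δ s t T) : MapsSob Δ s t (c • T) := by
  obtain ⟨C, hC⟩ := hT
  refine ⟨‖c‖ * C, fun v => ?_⟩
  have : sobNorm Δ 2 t ((c • T) v) = ‖c‖ * sobNorm Δ 2 t (T v) := by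
    simp only [sobNorm, LinearMap.smul_apply, map_smul, Submodule.coe_smul, norm_smul]
  rw [this, mul_assoc]
  gcongr
  exact hC v

lemma neg (hT : MapsSob Δ s t T) : MapsSob Δ s t (-T) := by
  rw [← neg_one_smul ℂ T]
  exact hT.smul (-1)

lemma sub (hT : MapsSob Δ s t T) (hU : MapsSob Δ s t U) : MapsSob Δ s t (T - U) := by
  rw [sub_eq_add_neg]
  exact hT.add hU.neg

lemma mul (hT : MapsSob Δ t r T) (hU : MapsSob Δ s t U) : MapsSob Δ s r (T * U) := by
  obtain ⟨C, hC0, hC⟩ := hT.exists_pos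
  obtain ⟨C', hC'⟩ := hU
  refine ⟨C * C', fun v => (hC (U v)).trans ?_⟩
  rw [mul_assoc]
  gcongr
  exact hC' v

lemma mono (h : LapDiag b Δ lam) {s' t' : ℝ} (hT : MapsSob Δ s t T) (hs : s ≤ s') (ht : t' ≤ t) :
    MapsSob Δ s' t' T := by
  obtain ⟨C, hC0, hC⟩ := hT.exists_pos
  refine ⟨C, fun v => (h.sobNorm_mono ht _).trans ((hC v).trans ?_)⟩
  gcongr
  exact h.sobNorm_mono hs v

end MapsSob

namespace LapDiag

lemma mapsSob_sobPow (h : LapDiag b Δ lam) {s t : ℝ} {z : ℂ} (hz : t + z.re ≤ s) :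
    MapsSob Δ s t (sobPow Δ z) :=
  ⟨1, fun v => by rw [h.sobNorm_sobPow, one_mul]; exact h.sobNorm_mono hz v⟩

lemma mapsSob_one (h : LapDiag b Δ lam) {s t : ℝ} (hst : t ≤ s) :
    MapsSob Δ s t (1 : SmoothEnd Δ) := by
  rw [← h.sobPow_zero]
  exact h.mapsSob_sobPow (by simpa using hst)

/-- A quadratic bound for the sesquilinear form of `T` on finite linear combinations of basis
vectors gives a norm bound on `H^∞`. -/
lemma norm_le_of_forall_finVec (h : LapDiag b Δ lam) {T : SmoothEnd Δ} {s t : ℝ}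
    (hT : MapsSob Δ s t T) {K : ℝ} (hK : 0 < K)
    (hle : ∀ (G F : Finset ι) (u v : ι → ℂ),
      (⟪(h.finVec G u : H), (T (h.finVec F v) : H)⟫_ℂ).re ≤
        K * (‖(h.finVec G u : H)‖ ^ 2 + ‖(h.finVec F v : H)‖ ^ 2)) (v : smooth Δ) :
    ‖(T v : H)‖ ≤ 2 * K * ‖(v : H)‖ := by
  -- The coordinates of `T v` are limits of those of `T` applied to truncations of `v`.
  have hcoord : ∀ i, Filter.Tendsto (fun F => ⟪b i, (T (h.trunc F v) : H)⟫_ℂ) Filter.atTop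
      (nhds ⟪b i, (T v : H)⟫_ℂ) := by
    intro i
    obtain ⟨C, hC⟩ := hT
    rw [tendsto_iff_norm_sub_tendsto_zero]
    have hpos : 0 < lam i ^ (t / 2) := Real.rpow_pos_of_pos (h.pos i) _
    have h0 : Filter.Tendsto (fun F => (lam i ^ (t / 2))⁻¹ *
        (C * sobNorm Δ 2 s (h.trunc F v - v))) Filter.atTop (nhds 0) := by
      have := ((h.tendsto_sobNorm_sub_trunc s v).const_mul C).const_mul (lam i ^ (t / 2))⁻¹
      rwa [mul_zero, mul_zero] at this
    refine squeeze_zero (fun F => norm_nonneg _) (fun F => ?_) h0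
    rw [le_inv_mul_iff₀ hpos, ← inner_sub_right, ← Submodule.coe_sub, ← map_sub]
    have h1 := h.norm_sobPow_coord (t : ℂ) (T (h.trunc F v - v)) i
    rw [Complex.ofReal_re] at h1
    rw [← h1]
    refine le_trans ?_ (hC _)
    have h2 := norm_inner_le_norm (𝕜 := ℂ) (b i) (sobPow Δ (t : ℂ) (T (h.trunc F v - v)) : H)
    rwa [b.orthonormal.1 i, one_mul] at h2
  have hfin : ∀ (G : Finset ι) (u : ι → ℂ),
      (⟪(h.finVec G u : H), (T v : H)⟫_ℂ).re ≤
        K * (‖(h.finVec G u : H)‖ ^ 2 + ‖(v : H)‖ ^ 2) := by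
    intro G u
    have h1 : Filter.Tendsto (fun F => ⟪(h.finVec G u : H), (T (h.trunc F v) : H)⟫_ℂ) Filter.atTop
        (nhds ⟪(h.finVec G u : H), (T v : H)⟫_ℂ) := by
      simp only [h.inner_finVec]
      exact tendsto_finsetSum _ fun i _ => (hcoord i).const_mul _
    have h2 : Filter.Tendsto (fun F => K * (‖(h.finVec G u : H)‖ ^ 2 + ‖(h.trunc F v : H)‖ ^ 2))
        Filter.atTop (nhds (K * (‖(h.finVec G u : H)‖ ^ 2 + ‖(v : H)‖ ^ 2))) :=
      (((h.tendsto_trunc v).norm.pow 2).const_add _).const_mul K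
    exact le_of_tendsto_of_tendsto' ((Complex.continuous_re.tendsto _).comp h1) h2
      fun F => hle G F u _
  -- Test against the truncations of `T v / (2 K)`.
  have hlim : (⟪(((2 * K)⁻¹ : ℝ) : ℂ) • (T v : H), (T v : H)⟫_ℂ).re ≤
      K * (‖(((2 * K)⁻¹ : ℝ) : ℂ) • (T v : H)‖ ^ 2 + ‖(v : H)‖ ^ 2) := by
    have h1 := h.tendsto_trunc ((((2 * K)⁻¹ : ℝ) : ℂ) • (T v : H))
    exact le_of_tendsto_of_tendsto' ((Complex.continuous_re.tendsto _).comp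
      (h1.inner tendsto_const_nhds)) (((h1.norm.pow 2).add_const _).const_mul K)
      fun F => hfin F _
  rw [inner_smul_left, Complex.conj_ofReal, Complex.re_ofReal_mul, norm_smul, Complex.norm_real,
    Real.norm_of_nonneg (by positivity)] at hlim
  have hre : (⟪(T v : H), (T v : H)⟫_ℂ).re = ‖(T v : H)‖ ^ 2 := by
    rw [inner_self_eq_norm_sq_to_K]
    norm_cast
  rw [hre] at hlim
  have h3 : ‖(T v : H)‖ ^ 2 ≤ (2 * K * ‖(v : H)‖) ^ 2 := by
    have h4 : (2 * K)⁻¹ * ‖(T v : H)‖ ^ 2 - K * ((2 * K)⁻¹ * ‖(T v : H)‖) ^ 2 =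
        (4 * K)⁻¹ * ‖(T v : H)‖ ^ 2 := by
      field_simp
      ring
    have h5 : (4 * K)⁻¹ * ‖(T v : H)‖ ^ 2 ≤ K * ‖(v : H)‖ ^ 2 := by linarith
    rw [inv_mul_le_iff₀ (by positivity)] at h5
    linarith
  exact (sq_le_sq₀ (norm_nonneg _) (by positivity)).mp h3

/-- Boundedness from order `s` to order `t` is boundedness on `H` after conjugation. -/
lemma mapsSob_of_conj (h : LapDiag b Δ lam) {T : SmoothEnd Δ} {s t K : ℝ}
    (hT : ∀ v : smooth Δ, ‖((sobPow Δ t * T * sobPow Δ (-s)) v : H)‖ ≤ K * ‖(v : H)‖) :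
    MapsSob Δ s t T := by
  refine ⟨K, fun v => ?_⟩
  have h1 := hT (sobPow Δ s v)
  rwa [← Module.End.mul_apply, mul_assoc, h.sobPow_neg_mul, mul_one, Module.End.mul_apply] at h1

lemma mapsSob_conj (h : LapDiag b Δ lam) {T : SmoothEnd Δ} {s t s' t' : ℝ}
    (hT : MapsSob Δ s' t' T) :
    MapsSob Δ (s' - s) (t' - t) (sobPow Δ t * T * sobPow Δ (-s)) :=
  ((h.mapsSob_sobPow (by simp)).mul hT).mul
    (h.mapsSob_sobPow (by simp))

lemma conj_finVec_eq_sum (h : LapDiag b Δ lam) (T : SmoothEnd Δ) (z w : ℂ) (G F : Finset ι)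
    (u v : ι → ℂ) :
    ⟪(h.finVec G u : H), ((sobPow Δ z * T * sobPow Δ w) (h.finVec F v) : H)⟫_ℂ =
      ∑ i ∈ G, ∑ j ∈ F, starRingEnd ℂ (u i) * v j * ((lam i : ℂ) ^ (z / (2 : ℕ)) *
        (lam j : ℂ) ^ (w / (2 : ℕ)) * ⟪b i, (T (h.basisVec j) : H)⟫_ℂ) := by
  rw [Module.End.mul_apply, Module.End.mul_apply, sobPow_finVec, h.inner_finVec]
  refine Finset.sum_congr rfl fun i _ => ?_
  rw [h.powOp_coord, finVec, map_sum, AddSubmonoidClass.coe_finsetSum, inner_sum, Finset.mul_sum,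
    Finset.mul_sum]
  refine Finset.sum_congr rfl fun j _ => ?_
  rw [map_smul, Submodule.coe_smul, inner_smul_right]
  ring

end LapDiag

/-- Interpolation in the Sobolev scale, by the three lines theorem. -/
theorem MapsSob.interpolate (h : LapDiag b Δ lam) {T : SmoothEnd Δ} {s₀ t₀ s₁ t₁ a : ℝ}
    (h0 : MapsSob Δ s₀ t₀ T) (h1 : MapsSob Δ s₁ t₁ T) (ha : 0 ≤ a) (ha' : a ≤ 1) :
    MapsSob Δ (s₀ + a * (s₁ - s₀)) (t₀ + a * (t₁ - t₀)) T := by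
  obtain ⟨C₀, hC₀, h0'⟩ := h0.exists_pos
  obtain ⟨C₁, hC₁, h1'⟩ := h1.exists_pos
  set C := max C₀ C₁ with hC
  have hCpos : 0 < C := hC₀.trans_le (le_max_left _ _)
  refine h.mapsSob_of_conj (K := 2 * C) fun v =>
    h.norm_le_of_forall_finVec (h.mapsSob_conj h0) hCpos (fun G F u v => ?_) v
  set nu := ‖(h.finVec G u : H)‖
  set nv := ‖(h.finVec F v : H)‖
  set f : ℂ → ℂ := fun z => ⟪(h.finVec G u : H), ((sobPow Δ (t₀ + z * (t₁ - t₀)) * T *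
    sobPow Δ (-(s₀ + z * (s₁ - s₀)))) (h.finVec F v) : H)⟫_ℂ with hf
  have hfa : ⟪(h.finVec G u : H), ((sobPow Δ ((t₀ + a * (t₁ - t₀) : ℝ) : ℂ) * T *
      sobPow Δ (-((s₀ + a * (s₁ - s₀) : ℝ) : ℂ))) (h.finVec F v) : H)⟫_ℂ = f a := by
    simp only [hf]
    push_cast
    rfl
  have hfsum : f = fun z : ℂ => ∑ i ∈ G, ∑ j ∈ F, starRingEnd ℂ (u i) * v j *
      ((lam i : ℂ) ^ ((t₀ + z * (t₁ - t₀)) / (2 : ℕ)) *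
        (lam j : ℂ) ^ (-(s₀ + z * (s₁ - s₀)) / (2 : ℕ)) * ⟪b i, (T (h.basisVec j) : H)⟫_ℂ) :=
    funext fun z => h.conj_finVec_eq_sum T _ _ G F u v
  have hdiff : Differentiable ℂ f := by
    rw [hfsum]
    simp only [Complex.cpow_def_of_ne_zero (h.ofReal_ne_zero _)]
    fun_prop
  have hre : ∀ (z : ℂ) (p q : ℝ), ((p : ℂ) + z * (q - p)).re = p + z.re * (q - p) := by
    intro z p q
    rw [← Complex.ofReal_sub, Complex.add_re, Complex.re_mul_ofReal, Complex.ofReal_re]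
  have hbdd : BddAbove ((norm ∘ f) '' Complex.HadamardThreeLines.verticalClosedStrip 0 1) := by
    refine ⟨∑ i ∈ G, ∑ j ∈ F, ‖starRingEnd ℂ (u i) * v j‖ * (lam i ^ ((|t₀| + |t₁ - t₀|) / 2) *
        lam j ^ ((|s₀| + |s₁ - s₀|) / 2) * ‖⟪b i, (T (h.basisVec j) : H)⟫_ℂ‖), ?_⟩
    rintro _ ⟨z, hz, rfl⟩
    have hz' : 0 ≤ z.re ∧ z.re ≤ 1 := hz
    have hb : ∀ p q : ℝ, |p + z.re * (q - p)| ≤ |p| + |q - p| := by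
      intro p q
      refine (abs_add_le _ _).trans ?_
      rw [abs_mul, abs_of_nonneg hz'.1]
      nlinarith [abs_nonneg (q - p)]
    rw [Function.comp_apply, hfsum]
    refine (norm_sum_le _ _).trans (Finset.sum_le_sum fun i _ => (norm_sum_le _ _).trans
      (Finset.sum_le_sum fun j _ => ?_))
    rw [norm_mul, norm_mul (_ * _) ⟪_, _⟫_ℂ, norm_mul ((lam i : ℂ) ^ _),
      Complex.norm_cpow_eq_rpow_re_of_pos (h.pos i), Complex.norm_cpow_eq_rpow_re_of_pos (h.pos j),
      Complex.div_natCast_re, Complex.div_natCast_re, Complex.neg_re, hre, hre, Nat.cast_ofNat]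
    have hpi := (h.pos i).le
    have hpj := (h.pos j).le
    have e1 : lam i ^ ((t₀ + z.re * (t₁ - t₀)) / 2) ≤ lam i ^ ((|t₀| + |t₁ - t₀|) / 2) :=
      Real.rpow_le_rpow_of_exponent_le (h.one_le i)
        (by linarith [(le_abs_self _).trans (hb t₀ t₁)])
    have e2 : lam j ^ (-(s₀ + z.re * (s₁ - s₀)) / 2) ≤ lam j ^ ((|s₀| + |s₁ - s₀|) / 2) :=
      Real.rpow_le_rpow_of_exponent_le (h.one_le j)
        (by linarith [(neg_le_abs _).trans (hb s₀ s₁)])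
    gcongr
  have hbound : ∀ (z : ℂ) (p q C' : ℝ), C' ≤ C → (t₀ + z.re * (t₁ - t₀)) = q →
      (s₀ + z.re * (s₁ - s₀)) = p →
      (∀ v : smooth Δ, sobNorm Δ 2 q (T v) ≤ C' * sobNorm Δ 2 p v) → ‖f z‖ ≤ C * (nu * nv) := by
    intro z p q C' hC' hq hp hT
    refine (norm_inner_le_norm _ _).trans ?_
    rw [mul_left_comm]
    gcongr
    rw [Module.End.mul_apply, Module.End.mul_apply, h.norm_sobPow, hre, hq]
    refine (hT _).trans ?_
    rw [h.sobNorm_sobPow, Complex.neg_re, hre, hp, add_neg_cancel, h.sobNorm_zero]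
    gcongr
  have key := Complex.HadamardThreeLines.norm_le_interp_of_mem_verticalClosedStrip₀₁' f
    (z := (a : ℂ)) (a := C * (nu * nv)) (b := C * (nu * nv)) ⟨ha, ha'⟩ hdiff.diffContOnCl hbdd
    (fun z hz => hbound z s₀ t₀ C₀ (le_max_left _ _) (by
      rw [show z.re = 0 from hz]; ring) (by rw [show z.re = 0 from hz]; ring) h0')
    (fun z hz => hbound z s₁ t₁ C₁ (le_max_right _ _) (by
      rw [show z.re = 1 from hz]; ring) (by rw [show z.re = 1 from hz]; ring) h1')
  have hnu : 0 ≤ nu := norm_nonneg _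
  have hnv : 0 ≤ nv := norm_nonneg _
  rw [Complex.ofReal_re, ← Real.rpow_add_of_nonneg (by positivity) (by linarith) ha,
    sub_add_cancel, Real.rpow_one] at key
  rw [hfa]
  refine (Complex.re_le_norm _).trans (key.trans ?_)
  gcongr
  nlinarith [sq_nonneg (nu - nv), sq_nonneg nu, sq_nonneg nv]

end Sobolev

/-! ### The Lyapunov equation `Λ Z + μ Z Λ = Y` -/

section Lyapunov

variable {H : Type*} [NormedAddCommGroup H] [InnerProductSpace ℂ H] {ι : Type*}
  {b : HilbertBasis ι ℂ H} {Δ : H →ₗ.[ℂ] H} {lam : ι → ℝ}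

lemma hasDerivAt_sum_exp {κ : Type*} (F : Finset κ) (k c : κ → ℝ) (s : ℝ) :
    HasDerivAt (fun s => ∑ i ∈ F, c i * Real.exp (-(k i * s)))
      (-∑ i ∈ F, k i * c i * Real.exp (-(k i * s))) s := by
  rw [← Finset.sum_neg_distrib]
  refine HasDerivAt.fun_sum fun i _ => ?_
  have h1 : HasDerivAt (fun s => -(k i * s)) (-(k i * 1)) s :=
    ((hasDerivAt_id' s).const_mul (k i)).neg
  exact (h1.exp.const_mul (c i)).congr_deriv (by ring)

lemma tendsto_sum_exp {κ : Type*} (F : Finset κ) {k : κ → ℝ} (c : κ → ℝ) (hk : ∀ i, 0 < k i) :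
    Filter.Tendsto (fun s => ∑ i ∈ F, c i * Real.exp (-(k i * s))) Filter.atTop (nhds 0) := by
  rw [← Finset.sum_const_zero (s := F)]
  refine tendsto_finsetSum _ fun i _ => ?_
  rw [← mul_zero (c i)]
  refine Filter.Tendsto.const_mul _ (Real.tendsto_exp_neg_atTop_nhds_zero.comp ?_)
  exact Filter.tendsto_id.const_mul_atTop (hk i)

/-- The Schur multiplier `√(a c) / (a + c)`, for positive `a = α i` and `c = γ j`, is bounded.
The matrix `w` is recovered from `m i j = (α i + γ j) / √(α i γ j) * w i j` by integrating
`-d/ds ⟨e^{-s α} u, w e^{-s γ} v⟩` over the half-line; this derivative is dominated by that of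
`‖e^{-s α} u‖² + ‖e^{-s γ} v‖²`. -/
lemma re_sum_le_of_schur {κ : Type*} (G F : Finset κ) {α γ : κ → ℝ} (hα : ∀ i, 0 < α i)
    (hγ : ∀ i, 0 < γ i) {w m : κ → κ → ℂ} {C : ℝ}
    (hm : ∀ i j, ((α i + γ j : ℝ) : ℂ) * w i j = ((√(α i) * √(γ j) : ℝ) : ℂ) * m i j)
    (hC : ∀ u v : κ → ℂ, (∑ i ∈ G, ∑ j ∈ F, starRingEnd ℂ (u i) * v j * m i j).re ≤
      C * (∑ i ∈ G, ‖u i‖ ^ 2 + ∑ j ∈ F, ‖v j‖ ^ 2)) (u v : κ → ℂ) :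
    (∑ i ∈ G, ∑ j ∈ F, starRingEnd ℂ (u i) * v j * w i j).re ≤
      C / 2 * (∑ i ∈ G, ‖u i‖ ^ 2 + ∑ j ∈ F, ‖v j‖ ^ 2) := by
  set p : ℝ → ℝ := fun s => ∑ i ∈ G, ‖u i‖ ^ 2 * Real.exp (-(2 * α i * s)) with hp
  set q : ℝ → ℝ := fun s => ∑ j ∈ F, ‖v j‖ ^ 2 * Real.exp (-(2 * γ j * s)) with hq
  set f : ℝ → ℝ := fun s => ∑ a ∈ G ×ˢ F, (starRingEnd ℂ (u a.1) * v a.2 * w a.1 a.2).re *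
    Real.exp (-((α a.1 + γ a.2) * s)) with hf
  set g : ℝ → ℝ := fun s => C / 2 * (p s + q s) - f s with hg
  have hgd : ∀ s, HasDerivAt g (C / 2 * (-∑ i ∈ G, 2 * α i * ‖u i‖ ^ 2 * Real.exp (-(2 * α i * s)) +
      -∑ j ∈ F, 2 * γ j * ‖v j‖ ^ 2 * Real.exp (-(2 * γ j * s))) -
      -∑ a ∈ G ×ˢ F, (α a.1 + γ a.2) * (starRingEnd ℂ (u a.1) * v a.2 * w a.1 a.2).re *
        Real.exp (-((α a.1 + γ a.2) * s))) s := fun s =>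
    (((hasDerivAt_sum_exp G (fun i => 2 * α i) (fun i => ‖u i‖ ^ 2) s).add
      (hasDerivAt_sum_exp F (fun j => 2 * γ j) (fun j => ‖v j‖ ^ 2) s)).const_mul (C / 2)).sub
      (hasDerivAt_sum_exp (G ×ˢ F) (fun a => α a.1 + γ a.2)
        (fun a => (starRingEnd ℂ (u a.1) * v a.2 * w a.1 a.2).re) s)
  have hanti : Antitone g := by
    refine antitone_of_hasDerivAt_nonpos hgd fun s => ?_
    have h1 := hC (fun i => ((√(α i) * Real.exp (-(α i * s)) : ℝ) : ℂ) * u i)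
      (fun j => ((√(γ j) * Real.exp (-(γ j * s)) : ℝ) : ℂ) * v j)
    have hnorm : ∀ (k : ℝ) (y : ℂ), 0 < k → ‖((√k * Real.exp (-(k * s)) : ℝ) : ℂ) * y‖ ^ 2 =
        k * ‖y‖ ^ 2 * Real.exp (-(2 * k * s)) := by
      intro k y hk
      rw [norm_mul, Complex.norm_real, Real.norm_of_nonneg (by positivity), mul_pow, mul_pow,
        Real.sq_sqrt hk.le, ← Real.exp_nat_mul]
      rw [show ((2 : ℕ) : ℝ) * -(k * s) = -(2 * k * s) by push_cast; ring]
      ring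
    have h2 : (∑ i ∈ G, ∑ j ∈ F, starRingEnd ℂ (((√(α i) * Real.exp (-(α i * s)) : ℝ) : ℂ) * u i) *
        (((√(γ j) * Real.exp (-(γ j * s)) : ℝ) : ℂ) * v j) * m i j).re =
        ∑ a ∈ G ×ˢ F, (α a.1 + γ a.2) * (starRingEnd ℂ (u a.1) * v a.2 * w a.1 a.2).re *
        Real.exp (-((α a.1 + γ a.2) * s)) := by
      rw [Finset.sum_product, Complex.re_sum]
      refine Finset.sum_congr rfl fun i _ => ?_
      rw [Complex.re_sum]
      refine Finset.sum_congr rfl fun j _ => ?_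
      have : starRingEnd ℂ (((√(α i) * Real.exp (-(α i * s)) : ℝ) : ℂ) * u i) *
        (((√(γ j) * Real.exp (-(γ j * s)) : ℝ) : ℂ) * v j) * m i j =
          ((Real.exp (-((α i + γ j) * s)) * (α i + γ j) : ℝ) : ℂ) *
            (starRingEnd ℂ (u i) * v j * w i j) := by
        rw [map_mul, Complex.conj_ofReal, add_mul (α i), neg_add, Real.exp_add]
        push_cast at hm ⊢
        linear_combination (-starRingEnd ℂ (u i) * v j * Complex.exp (-(α i * s)) *
          Complex.exp (-(γ j * s))) * hm i j
      rw [this, Complex.re_ofReal_mul]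
      ring
    rw [h2] at h1
    rw [Finset.sum_congr rfl fun i _ => hnorm (α i) (u i) (hα i),
      Finset.sum_congr rfl fun j _ => hnorm (γ j) (v j) (hγ j)] at h1
    simp only [mul_assoc (2 : ℝ), ← Finset.mul_sum, Pi.zero_apply] at h1 ⊢
    linarith
  have hlim : Filter.Tendsto g Filter.atTop (nhds 0) := by
    have := (((tendsto_sum_exp G (fun i => ‖u i‖ ^ 2) fun i => mul_pos two_pos (hα i)).add
      (tendsto_sum_exp F (fun j => ‖v j‖ ^ 2) fun j => mul_pos two_pos (hγ j))).const_mul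
      (C / 2)).sub (tendsto_sum_exp (G ×ˢ F) (k := fun a => α a.1 + γ a.2)
        (fun a => (starRingEnd ℂ (u a.1) * v a.2 * w a.1 a.2).re) fun a => add_pos (hα _) (hγ _))
    rwa [add_zero, mul_zero, sub_zero] at this
  have h0 := hanti.le_of_tendsto hlim 0
  simp only [hg, hp, hq, hf, mul_zero, neg_zero, Real.exp_zero, mul_one, Finset.sum_product] at h0
  simp only [Complex.re_sum]
  linarith

/-- A gain of one order for solutions of the Lyapunov equation `Λ Z + μ Z Λ = Y`: the operator `Z`
arises from `Λ ^ (-1/2) Y Λ ^ (-1/2)` by a bounded Schur multiplier. -/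
theorem MapsSob.of_lyapunov (h : LapDiag b Δ lam) {Z : SmoothEnd Δ} {μ s t s' t' : ℝ} (hμ : 0 < μ)
    (hZ : MapsSob Δ s' t' Z)
    (hY : MapsSob Δ (s + 1 / 2) (t - 1 / 2) (sobPow Δ 1 * Z + (μ : ℂ) • (Z * sobPow Δ 1))) :
    MapsSob Δ s t Z := by
  set Y := sobPow Δ 1 * Z + (μ : ℂ) • (Z * sobPow Δ 1) with hYdef
  have hT := h.mapsSob_conj (s := s + 1 / 2) (t := t - 1 / 2) hY
  rw [sub_self, sub_self] at hT
  obtain ⟨C, hC0, hC⟩ := hT.exists_pos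
  simp only [h.sobNorm_zero] at hC
  set α : ι → ℝ := fun i => lam i ^ (1 / 2 : ℝ) with hα
  have hαpos : ∀ i, 0 < α i := fun i => Real.rpow_pos_of_pos (h.pos i) _
  have hαc : ∀ i, (lam i : ℂ) ^ ((1 : ℂ) / (2 : ℕ)) = α i := by
    intro i
    rw [hα, Complex.ofReal_cpow (h.pos i).le]
    push_cast
    rfl
  have hYm : ∀ i j, ⟪b i, (Y (h.basisVec j) : H)⟫_ℂ =
      (α i + μ * α j) * ⟪b i, (Z (h.basisVec j) : H)⟫_ℂ := by
    intro i j
    have hb : sobPow Δ 1 (h.basisVec j) = (α j : ℂ) • h.basisVec j := by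
      have := h.sobPow_finVec 1 {j} fun _ => 1
      rw [LapDiag.finVec, LapDiag.finVec, Finset.sum_singleton, Finset.sum_singleton, one_smul,
        mul_one, hαc] at this
      exact this
    rw [hYdef, LinearMap.add_apply, LinearMap.smul_apply, Module.End.mul_apply,
      Module.End.mul_apply, hb, map_smul, Submodule.coe_add, Submodule.coe_smul, Submodule.coe_smul,
      inner_add_right,
      inner_smul_right, inner_smul_right, h.powOp_coord, hαc]
    ring
  refine h.mapsSob_of_conj (K := 2 * (C * (√μ)⁻¹ / 2 / 2)) fun v =>
    h.norm_le_of_forall_finVec (h.mapsSob_conj hZ) (by positivity) (fun G F u v => ?_) v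
  have hpow : ∀ (i : ι) (x y : ℝ), ((lam i : ℂ) ^ (((x + y : ℝ) : ℂ) / (2 : ℕ))) =
      (lam i : ℂ) ^ ((x : ℂ) / (2 : ℕ)) * (lam i : ℂ) ^ ((y : ℂ) / (2 : ℕ)) := by
    intro i x y
    rw [← Complex.cpow_add _ _ (h.ofReal_ne_zero i), ← add_div, Complex.ofReal_add]
  have hsqrt : ∀ i, (lam i : ℂ) ^ (((1 / 2 : ℝ) : ℂ) / (2 : ℕ)) = (√(α i) : ℝ) := by
    intro i
    rw [hα, Real.sqrt_eq_rpow, ← Real.rpow_mul (h.pos i).le, Complex.ofReal_cpow (h.pos i).le]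
    congr 1
    push_cast
    ring
  have hsm : ((√μ : ℝ) : ℂ) ≠ 0 := Complex.ofReal_ne_zero.mpr (Real.sqrt_pos.mpr hμ).ne'
  have hS := h.conj_finVec_eq_sum Y ((t - 1 / 2 : ℝ) : ℂ) (-((s + 1 / 2 : ℝ) : ℂ)) G F
  rw [h.conj_finVec_eq_sum, h.normSq_finVec, h.normSq_finVec]
  refine re_sum_le_of_schur G F (γ := fun j => μ * α j) hαpos (fun j => mul_pos hμ (hαpos j))
    (m := fun i j => ((√μ : ℝ) : ℂ)⁻¹ * ((lam i : ℂ) ^ (((t - 1 / 2 : ℝ) : ℂ) / (2 : ℕ)) *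
      (lam j : ℂ) ^ (-((s + 1 / 2 : ℝ) : ℂ) / (2 : ℕ)) * ⟪b i, (Y (h.basisVec j) : H)⟫_ℂ))
    (fun i j => ?_) (fun u v => ?_) u v
  · have e1 := hpow i (t - 1 / 2) (1 / 2)
    have e2 := hpow j (-(s + 1 / 2)) (1 / 2)
    rw [sub_add_cancel, hsqrt] at e1
    rw [neg_add, neg_add_cancel_right, hsqrt, ← neg_add] at e2
    rw [e1, ← Complex.ofReal_neg s, e2, hYm, Real.sqrt_mul hμ.le]
    push_cast
    field_simp
  · have h1 := congrArg Complex.re (hS u v)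
    have h2 : ∀ i j, starRingEnd ℂ (u i) * v j * (((√μ : ℝ) : ℂ)⁻¹ *
        ((lam i : ℂ) ^ (((t - 1 / 2 : ℝ) : ℂ) / (2 : ℕ)) *
        (lam j : ℂ) ^ (-((s + 1 / 2 : ℝ) : ℂ) / (2 : ℕ)) * ⟪b i, (Y (h.basisVec j) : H)⟫_ℂ)) =
        (((√μ)⁻¹ : ℝ) : ℂ) * (starRingEnd ℂ (u i) * v j *
        ((lam i : ℂ) ^ (((t - 1 / 2 : ℝ) : ℂ) / (2 : ℕ)) *
        (lam j : ℂ) ^ (-((s + 1 / 2 : ℝ) : ℂ) / (2 : ℕ)) * ⟪b i, (Y (h.basisVec j) : H)⟫_ℂ)) := by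
      intro i j
      push_cast
      ring
    simp only [h2, ← Finset.mul_sum]
    rw [Complex.re_ofReal_mul, ← h1, ← h.normSq_finVec, ← h.normSq_finVec]
    have h3 := (Complex.re_le_norm _).trans ((norm_inner_le_norm (𝕜 := ℂ)
      (h.finVec G u : H) _).trans (mul_le_mul_of_nonneg_left (hC (h.finVec F v)) (norm_nonneg _)))
    have h4 : ∀ x : ℝ, C * (√μ)⁻¹ / 2 * x = (√μ)⁻¹ * (C / 2 * x) := fun x => by ring
    rw [h4]
    refine mul_le_mul_of_nonneg_left (h3.trans ?_) (by positivity)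
    nlinarith [mul_nonneg hC0.le (sq_nonneg (‖(h.finVec G u : H)‖ - ‖(h.finVec F v : H)‖))]

end Lyapunov

/-! ### Operators of finite analytic order -/

section Op

variable {H : Type*} [NormedAddCommGroup H] [InnerProductSpace ℂ H] {ι : Type*}
  {b : HilbertBasis ι ℂ H} {Δ : H →ₗ.[ℂ] H} {lam : ι → ℝ}

lemma IsOp.mapsSob {t : ℝ} {T : SmoothEnd Δ} (hT : IsOp Δ 2 t T) {s s' : ℝ} (hs : s - t = s') :
    MapsSob Δ s s' T := by
  subst hs
  exact hT s

lemma IsOp.add {t : ℝ} {T U : SmoothEnd Δ} (hT : IsOp Δ 2 t T) (hU : IsOp Δ 2 t U) :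
    IsOp Δ 2 t (T + U) := fun s => MapsSob.add (hT s) (hU s)

lemma IsOp.sub {t : ℝ} {T U : SmoothEnd Δ} (hT : IsOp Δ 2 t T) (hU : IsOp Δ 2 t U) :
    IsOp Δ 2 t (T - U) := fun s => MapsSob.sub (hT s) (hU s)

lemma IsOp.smul {t : ℝ} {T : SmoothEnd Δ} (c : ℂ) (hT : IsOp Δ 2 t T) : IsOp Δ 2 t (c • T) :=
  fun s => MapsSob.smul c (hT s)

lemma IsOp.sub_symm {t : ℝ} {T U : SmoothEnd Δ} (hTU : IsOp Δ 2 t (T - U)) :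
    IsOp Δ 2 t (U - T) := fun s => by
  rw [← neg_sub T U]
  exact MapsSob.neg (hTU s)

lemma IsOp.mul {s t : ℝ} {T U : SmoothEnd Δ} (hT : IsOp Δ 2 s T) (hU : IsOp Δ 2 t U) :
    IsOp Δ 2 (s + t) (T * U) := fun σ =>
  (hT.mapsSob (by ring : σ - t - s = σ - (s + t))).mul (hU σ)

lemma IsOp.mono (h : LapDiag b Δ lam) {s t : ℝ} (hst : s ≤ t) {T : SmoothEnd Δ}
    (hT : IsOp Δ 2 s T) : IsOp Δ 2 t T :=
  fun σ => MapsSob.mono h (hT σ) le_rfl (by linarith)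

lemma LapDiag.isOp_sobPow (h : LapDiag b Δ lam) (z : ℂ) : IsOp Δ 2 z.re (sobPow Δ z) :=
  fun s => h.mapsSob_sobPow (by linarith)

lemma LapDiag.isOp_one (h : LapDiag b Δ lam) : IsOp Δ 2 0 (1 : SmoothEnd Δ) :=
  fun s => h.mapsSob_one (by linarith)

/-- Interpolation between two Sobolev spaces on which `T` has order `t`. -/
lemma MapsSob.between (h : LapDiag b Δ lam) {T : SmoothEnd Δ} {s₀ s₁ s t : ℝ}
    (h0 : MapsSob Δ s₀ (s₀ - t) T) (h1 : MapsSob Δ s₁ (s₁ - t) T) (hs₀ : s₀ ≤ s) (hs₁ : s ≤ s₁) :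
    MapsSob Δ s (s - t) T := by
  rcases hs₀.eq_or_lt with rfl | hlt
  · exact h0
  have hne : s₁ - s₀ ≠ 0 := by linarith
  have h2 := h0.interpolate h h1 (a := (s - s₀) / (s₁ - s₀))
    (div_nonneg (by linarith) (by linarith))
    ((div_le_one (by linarith)).mpr (by linarith))
  have e : (s - s₀) / (s₁ - s₀) * (s₁ - s₀) = s - s₀ := div_mul_cancel₀ _ hne
  rw [show s₁ - t - (s₀ - t) = s₁ - s₀ by ring, e] at h2
  exact h2.mono h (by linarith) (by linarith)

variable (Δ) in
/-- The subspace `Op^t` of operators of analytic order at most `t`. -/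
def opFil (t : ℝ) : Submodule ℂ (SmoothEnd Δ) where
  carrier := {T | IsOp Δ 2 t T}
  add_mem' := IsOp.add
  zero_mem' := fun _ => MapsSob.zero
  smul_mem' := fun c _ hT => hT.smul c

/-- The algebra `Op` of operators of finite analytic order. -/
def LapDiag.opAlg (h : LapDiag b Δ lam) : Subalgebra ℂ (SmoothEnd Δ) where
  carrier := {T | ∃ t : ℝ, IsOp Δ 2 t T}
  mul_mem' := fun ⟨s, hs⟩ ⟨t, ht⟩ => ⟨s + t, hs.mul ht⟩
  add_mem' := fun ⟨s, hs⟩ ⟨t, ht⟩ =>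
    ⟨max s t, (hs.mono h (le_max_left s t)).add (ht.mono h (le_max_right s t))⟩
  algebraMap_mem' := fun c => ⟨0, by
    rw [Algebra.algebraMap_eq_smul_one]
    exact h.isOp_one.smul c⟩

lemma LapDiag.mem_opAlg (h : LapDiag b Δ lam) {T : SmoothEnd Δ} :
    T ∈ h.opAlg ↔ ∃ t : ℝ, IsOp Δ 2 t T := Iff.rfl

/-- Conjugation `T ↦ Λ ^ z T Λ ^ (-z)` by a complex power of the Laplace operator, as an
automorphism of `Op`. -/
def LapDiag.opConj (h : LapDiag b Δ lam) (z : ℂ) : h.opAlg ≃ₐ[ℂ] h.opAlg :=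
  have hmem : ∀ (w : ℂ) (T : h.opAlg),
      sobPow Δ w * (T : SmoothEnd Δ) * sobPow Δ (-w) ∈ h.opAlg := fun w T => by
    obtain ⟨t, ht⟩ := h.mem_opAlg.mp T.2
    exact ⟨_, ((h.isOp_sobPow w).mul ht).mul (h.isOp_sobPow (-w))⟩
  AlgEquiv.ofLinearEquiv
    { toFun := fun T => ⟨sobPow Δ z * (T : SmoothEnd Δ) * sobPow Δ (-z), hmem z T⟩
      invFun := fun T => ⟨sobPow Δ (-z) * (T : SmoothEnd Δ) * sobPow Δ z, by
        simpa only [neg_neg] using hmem (-z) T⟩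
      map_add' := fun T U => Subtype.ext (by
        simp only [Subalgebra.coe_add, mul_add, add_mul])
      map_smul' := fun c T => Subtype.ext (by
        simp only [Subalgebra.coe_smul, mul_smul_comm, smul_mul_assoc, RingHom.id_apply])
      left_inv := fun T => Subtype.ext (by
        change sobPow Δ (-z) * (sobPow Δ z * (T : SmoothEnd Δ) * sobPow Δ (-z)) * sobPow Δ z = T
        rw [mul_assoc (sobPow Δ z), ← mul_assoc, h.sobPow_neg_mul, one_mul, mul_assoc,
          h.sobPow_neg_mul, mul_one])
      right_inv := fun T => Subtype.ext (by
        change sobPow Δ z * (sobPow Δ (-z) * (T : SmoothEnd Δ) * sobPow Δ z) * sobPow Δ (-z) = T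
        rw [mul_assoc (sobPow Δ (-z)), ← mul_assoc, h.sobPow_mul_neg, one_mul, mul_assoc,
          h.sobPow_mul_neg, mul_one]) }
    (Subtype.ext (by
      change sobPow Δ z * 1 * sobPow Δ (-z) = 1
      rw [mul_one, h.sobPow_mul_neg]))
    (fun T U => Subtype.ext (by
      change sobPow Δ z * ((T : SmoothEnd Δ) * U) * sobPow Δ (-z) =
        sobPow Δ z * (T : SmoothEnd Δ) * sobPow Δ (-z) *
          (sobPow Δ z * (U : SmoothEnd Δ) * sobPow Δ (-z))
      rw [mul_assoc (sobPow Δ z * (T : SmoothEnd Δ)), mul_assoc (sobPow Δ z) (U : SmoothEnd Δ),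
        ← mul_assoc (sobPow Δ (-z)), h.sobPow_neg_mul, one_mul]
      simp only [mul_assoc]))

lemma LapDiag.coe_opConj (h : LapDiag b Δ lam) (z : ℂ) (T : h.opAlg) :
    (h.opConj z T : SmoothEnd Δ) = sobPow Δ z * (T : SmoothEnd Δ) * sobPow Δ (-z) := rfl

lemma LapDiag.opConj_mul_sobPow (h : LapDiag b Δ lam) (z : ℂ) (T : h.opAlg) :
    (h.opConj z T : SmoothEnd Δ) * sobPow Δ z = sobPow Δ z * (T : SmoothEnd Δ) := by
  rw [h.coe_opConj, mul_assoc, h.sobPow_neg_mul, mul_one]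

lemma LapDiag.opConj_add (h : LapDiag b Δ lam) (z w : ℂ) (T : h.opAlg) :
    h.opConj (z + w) T = h.opConj z (h.opConj w T) := by
  apply Subtype.ext
  rw [h.coe_opConj, h.coe_opConj, h.coe_opConj, h.sobPow_add z w, neg_add_rev,
    h.sobPow_add (-w) (-z)]
  simp only [mul_assoc]

lemma LapDiag.isOp_opConj (h : LapDiag b Δ lam) (z : ℂ) {t : ℝ} {T : h.opAlg}
    (hT : IsOp Δ 2 t (T : SmoothEnd Δ)) : IsOp Δ 2 t (h.opConj z T : SmoothEnd Δ) := by
  have := ((h.isOp_sobPow z).mul hT).mul (h.isOp_sobPow (-z))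
  rw [Complex.neg_re, add_neg_cancel_comm] at this
  exact this

lemma LapDiag.isOp_opConj_iff (h : LapDiag b Δ lam) (z : ℂ) {t : ℝ} {T : h.opAlg} :
    IsOp Δ 2 t (h.opConj z T : SmoothEnd Δ) ↔ IsOp Δ 2 t (T : SmoothEnd Δ) := by
  refine ⟨fun hT => ?_, h.isOp_opConj z⟩
  have h1 := h.isOp_opConj (-z) hT
  rw [← h.opConj_add, neg_add_cancel] at h1
  have h2 : h.opConj 0 T = T := Subtype.ext (by
    rw [h.coe_opConj, neg_zero, h.sobPow_zero, one_mul, mul_one])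
  rwa [h2] at h1

lemma LapDiag.iSup_opFil (h : LapDiag b Δ lam) :
    ⨆ t, opFil Δ t = Subalgebra.toSubmodule h.opAlg := by
  apply le_antisymm
  · exact iSup_le fun t T hT => ⟨t, hT⟩
  · rintro T ⟨t, ht⟩
    exact Submodule.mem_iSup_of_mem t ht

end Op

/-! ### Twisted algebras of differential operators consist of operators of finite order -/

section DO

variable {H : Type*} [NormedAddCommGroup H] [InnerProductSpace ℂ H] {ι : Type*}
  {b : HilbertBasis ι ℂ H} {Δ : H →ₗ.[ℂ] H} {lam : ι → ℝ}

namespace TwistedDOAlgebra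

variable (𝓓 : TwistedDOAlgebra Δ 2)

lemma fil_le (m : ℕ) : 𝓓.fil m ≤ Subalgebra.toSubmodule 𝓓.carrier :=
  𝓓.fil_exhaust ▸ le_iSup 𝓓.fil m

/-- The filtration of `𝓓` by subspaces of its carrier. -/
def carrierFil (m : ℕ) : Submodule ℂ 𝓓.carrier :=
  (𝓓.fil m).comap (Subalgebra.toSubmodule 𝓓.carrier).subtype

lemma pow_two_θ_fil (m : ℕ) (X : 𝓓.carrier) :
    ((𝓓.θ ^ 2) X : SmoothEnd Δ) ∈ 𝓓.fil m ↔ (X : SmoothEnd Δ) ∈ 𝓓.fil m := by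
  rw [pow_two, LinearEquiv.mul_apply, 𝓓.θ_fil, 𝓓.θ_fil]

/-- Positive orders: the elliptic estimate is the case `k = 0`, and the twisted commutator with `Δ`
gives the step from `k` to `k + 1`. -/
lemma mapsSob_even (h : LapDiag b Δ lam) (k m : ℕ) {X : SmoothEnd Δ} (hX : X ∈ 𝓓.fil m) :
    MapsSob Δ (m + 2 * k) (2 * k) X := by
  induction k generalizing m X with
  | zero =>
    obtain ⟨C, -, hC⟩ := 𝓓.elliptic m X hX
    refine ⟨C, fun v => ?_⟩
    rw [Nat.cast_zero, mul_zero, add_zero, h.sobNorm_zero]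
    exact hC v
  | succ k ih =>
    -- `Λ ^ (2 k + 2) X = Λ ^ (2 k) (θ² X Δ + Y)` with `Y` of order `m + 1`
    have h1 := ih m ((𝓓.pow_two_θ_fil m ⟨X, 𝓓.fil_le m hX⟩).mpr hX)
    have h2 := ih (m + 1) (𝓓.nabla_mem m ⟨X, 𝓓.fil_le m hX⟩ hX)
    have h3 := (h1.mul (h.mapsSob_sobPow (z := 2) (s := m + 2 * (k + 1)) (by
      rw [Complex.re_ofNat]; linarith))).add (h2.mono h (s' := m + 2 * (k + 1)) (by
      push_cast; linarith) le_rfl)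
    rw [h.sobPow_two, add_sub_cancel] at h3
    obtain ⟨C, hC⟩ := h3
    refine ⟨C, fun v => ?_⟩
    have h4 := hC v
    rw [Module.End.mul_apply, ← h.sobPow_two, h.sobNorm_sobPow, Complex.re_ofNat] at h4
    push_cast
    rw [mul_add 2 (k : ℝ), mul_one] at h4 ⊢
    exact h4

lemma mapsSob_of_le (h : LapDiag b Δ lam) (m : ℕ) {X : SmoothEnd Δ} (hX : X ∈ 𝓓.fil m) {s : ℝ}
    (hs : m ≤ s) : MapsSob Δ s (s - m) X := by
  have h0 := 𝓓.mapsSob_even h 0 m hX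
  have h1 := 𝓓.mapsSob_even h ⌈s⌉₊ m hX
  refine MapsSob.between h (s₀ := m) (s₁ := m + 2 * ⌈s⌉₊) ?_ ?_ hs ?_
  · exact h0.mono h (by simp) (by simp)
  · rwa [add_sub_cancel_left]
  · have := Nat.le_ceil s
    have hm : (0 : ℝ) ≤ m := m.cast_nonneg
    linarith

/-- Negative orders, reached in steps that use the surjectivity of the twisting. -/
lemma mapsSob_of_sub_le (h : LapDiag b Δ lam) (n m : ℕ) {X : SmoothEnd Δ} (hX : X ∈ 𝓓.fil m)
    {s : ℝ} (hs : m - n ≤ s) : MapsSob Δ s (s - m) X := by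
  induction n generalizing m X s with
  | zero => exact 𝓓.mapsSob_of_le h m hX (by simpa using hs)
  | succ n ih =>
    -- With `X = θ² X'` one has `X = (Δ X' - Y) Δ⁻¹`, where `Y` has order `m + 1`.
    set X' : 𝓓.carrier := (𝓓.θ ^ 2).symm ⟨X, 𝓓.fil_le m hX⟩ with hX'
    have e : (𝓓.θ ^ 2) X' = ⟨X, 𝓓.fil_le m hX⟩ := LinearEquiv.apply_symm_apply _ _
    have hX'm : (X' : SmoothEnd Δ) ∈ 𝓓.fil m := by
      rw [← 𝓓.pow_two_θ_fil, e]
      exact hX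
    have hY := 𝓓.nabla_mem m X' hX'm
    rw [e] at hY
    push_cast at hs
    have h1 := ih m hX'm (s := s + 2) (by linarith)
    have h2 := ih (m + 1) hY (s := s + 2) (by push_cast; linarith)
    have h3 := ((h.mapsSob_sobPow (z := 2) (s := s + 2 - m) (t := s - m) (by
      rw [Complex.re_ofNat]; linarith)).mul h1).sub (h2.mono h (t' := s - m) le_rfl (by
      push_cast; linarith))
    have h4 := h3.mul (h.mapsSob_sobPow (z := -2) (s := s) (t := s + 2) (by
      rw [Complex.neg_re, Complex.re_ofNat]; linarith))
    rw [h.sobPow_two, sub_sub_cancel, mul_assoc, ← h.sobPow_two, h.sobPow_mul_neg, mul_one] at h4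
    exact h4

/-- The elements of `𝓓^m` have analytic order at most `m`. -/
theorem isOp_of_mem_fil (h : LapDiag b Δ lam) {m : ℕ} {X : SmoothEnd Δ} (hX : X ∈ 𝓓.fil m) :
    IsOp Δ 2 m X := fun s =>
  𝓓.mapsSob_of_sub_le h ⌈m - s⌉₊ m hX (by linarith [Nat.le_ceil (m - s)])

/-- If `X ∈ 𝓓^m` is an eigenvector of the twisting for a positive eigenvalue `μ`, then
`Z = Λ X - μ X Λ` solves the Lyapunov equation `Λ Z + μ Z Λ = Δ X - μ² X Δ`. -/
lemma isOp_twisted_comm_of_eigenvector (h : LapDiag b Δ lam) {m : ℕ} {X : 𝓓.carrier}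
    (hX : (X : SmoothEnd Δ) ∈ 𝓓.fil m) {μ : ℝ} (hμ : 0 < μ) (he : 𝓓.θ X = (μ : ℂ) • X) :
    IsOp Δ 2 m (sobPow Δ 1 * (X : SmoothEnd Δ) - (𝓓.θ X : SmoothEnd Δ) * sobPow Δ 1) := by
  have hop := 𝓓.isOp_of_mem_fil h hX
  have h1 := h.isOp_sobPow 1
  rw [Complex.one_re] at h1
  have hY := 𝓓.isOp_of_mem_fil h (𝓓.nabla_mem m X hX)
  rw [pow_two, LinearEquiv.mul_apply, he, map_smul, he, ← h.sobPow_one_mul_self] at hY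
  rw [he]
  simp only [Subalgebra.coe_smul] at hY ⊢
  have hZ : IsOp Δ 2 (1 + m)
      (sobPow Δ 1 * (X : SmoothEnd Δ) - ((μ : ℂ) • (X : SmoothEnd Δ)) * sobPow Δ 1) :=
    (h1.mul hop).sub (by rw [add_comm]; exact (hop.smul _).mul h1)
  intro s
  refine MapsSob.of_lyapunov h hμ (hZ s) ?_
  have hYs := hY.mapsSob (s := s + 1 / 2) (s' := s - m - 1 / 2) (by push_cast; ring)
  convert hYs using 1
  simp only [mul_sub, sub_mul, smul_sub, smul_mul_assoc, mul_smul_comm, mul_assoc]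
  abel

end TwistedDOAlgebra

/-- If a vector of an invariant subspace is a sum of eigenvectors, these lie in the subspace. -/
lemma mem_of_sum_eigenvectors_mem {K V : Type*} [Field K] [AddCommGroup V] [Module K V]
    {f : Module.End K V} {p : Submodule K V} (hp : ∀ x ∈ p, f x ∈ p) (s : Finset K) {x : K → V}
    (hx : ∀ μ, x μ ∈ Module.End.eigenspace f μ) (hs : ∑ μ ∈ s, x μ ∈ p) : ∀ μ ∈ s, x μ ∈ p := by
  classical
  induction s using Finset.induction_on generalizing x with
  | empty => simp
  | insert ν s hν ih =>
    have h1 : ∀ μ ∈ s, x μ ∈ p := by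
      have h2 : ∑ μ ∈ s, (μ - ν) • x μ ∈ p := by
        have h3 := p.sub_mem (hp _ hs) (p.smul_mem ν hs)
        rw [map_sum, Finset.smul_sum, ← Finset.sum_sub_distrib, Finset.sum_insert hν] at h3
        simp only [Module.End.mem_eigenspace_iff.mp (hx _), sub_self, zero_add, ← sub_smul] at h3
        exact h3
      intro μ hμ
      have h4 := ih (fun μ => Submodule.smul_mem _ _ (hx μ)) h2 μ hμ
      have hne : μ - ν ≠ 0 := sub_ne_zero.mpr fun h => hν (h ▸ hμ)
      rwa [Submodule.smul_mem_iff _ hne] at h4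
    have h5 : x ν ∈ p := by
      rw [Finset.sum_insert hν] at hs
      have := p.sub_mem hs (p.sum_mem h1)
      rwa [add_sub_cancel_right] at this
    intro μ hμ
    rcases Finset.mem_insert.mp hμ with rfl | hμ
    · exact h5
    · exact h1 μ hμ

/-- A vector of an invariant subspace that is a sum of eigenvectors is a sum of eigenvectors in the
subspace. -/
lemma exists_eigenvectors_sum_eq {K V : Type*} [Field K] [AddCommGroup V] [Module K V]
    {f : Module.End K V} {p : Submodule K V} (hp : ∀ x ∈ p, f x ∈ p) {v : V} (hv : v ∈ p)
    (hv' : v ∈ ⨆ μ, Module.End.eigenspace f μ) :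
    ∃ (s : Finset K) (x : K → V), (∀ μ ∈ s, f.HasEigenvector μ (x μ)) ∧ (∀ μ ∈ s, x μ ∈ p) ∧
      ∑ μ ∈ s, x μ = v := by
  obtain ⟨x, hx, rfl⟩ := (Submodule.mem_iSup_iff_exists_finsupp _ _).mp hv'
  exact ⟨x.support, x, fun μ hμ => ⟨hx μ, Finsupp.mem_support_iff.mp hμ⟩,
    mem_of_sum_eigenvectors_mem hp x.support hx hv, rfl⟩

/-- If the twisting is diagonalizable with positive spectrum, twisted commutators with
`Λ = Δ ^ (1 / 2)` do not raise the order. -/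
theorem TwistedDOAlgebra.isOp_twisted_comm (𝓓 : TwistedDOAlgebra Δ 2) (h : LapDiag b Δ lam)
    (hdiag : ⨆ μ : ℂ,
      Module.End.eigenspace (R := ℂ) (M := 𝓓.carrier) 𝓓.θ.toLinearMap μ = ⊤)
    (hpos : ∀ μ : ℂ, Module.End.HasEigenvalue (R := ℂ) (M := 𝓓.carrier) 𝓓.θ.toLinearMap μ →
      ∃ t : ℝ, 0 < t ∧ μ = t)
    {m : ℕ} {X : 𝓓.carrier} (hX : (X : SmoothEnd Δ) ∈ 𝓓.fil m) :
    IsOp Δ 2 m (sobPow Δ 1 * (X : SmoothEnd Δ) - (𝓓.θ X : SmoothEnd Δ) * sobPow Δ 1) := by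
  obtain ⟨s, x, hx, hxm, rfl⟩ := exists_eigenvectors_sum_eq (p := 𝓓.carrierFil m)
    (fun Y hY => (𝓓.θ_fil m Y).mpr hY) hX (hdiag ▸ Submodule.mem_top)
  rw [map_sum, AddSubmonoidClass.coe_finsetSum, AddSubmonoidClass.coe_finsetSum,
    Finset.mul_sum, Finset.sum_mul, ← Finset.sum_sub_distrib]
  refine (opFil Δ m).sum_mem fun μ hμ => ?_
  obtain ⟨t, ht, rfl⟩ := hpos μ (Module.End.hasEigenvalue_of_hasEigenvector (hx μ hμ))
  exact 𝓓.isOp_twisted_comm_of_eigenvector h (hxm _ hμ) ht (hx _ hμ).apply_eq_smul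

end DO

/-! ### Extending a twisting to a prescribed one modulo a subspace -/

/-- A linear automorphism `τ` of a subspace `W` of `V` (given by an injective map `j`) that agrees
with a linear automorphism `c` of `V` modulo a subspace `N` invariant under `c` extends to a
linear automorphism of `V` that agrees with `c` modulo `N`. The extension is the identity on a
complement of `W ∩ N` in `N`, which is what makes it bijective on `N`. -/
theorem exists_linearEquiv_extend {K V W : Type*} [Field K] [AddCommGroup V] [Module K V]
    [AddCommGroup W] [Module K W] (c : V ≃ₗ[K] V) (N : Submodule K V) (hcN : ∀ x, c x ∈ N ↔ x ∈ N)
    (j : W →ₗ[K] V) (hj : Function.Injective j) (τ : W ≃ₗ[K] W)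
    (hτ : ∀ w, j (τ w) - c (j w) ∈ N) :
    ∃ σ : V ≃ₗ[K] V, (∀ w, σ (j w) = j (τ w)) ∧ ∀ v, σ v - c v ∈ N := by
  obtain ⟨C', hC'⟩ := Submodule.exists_isCompl (LinearMap.range j ⊓ N)
  set C : Submodule K V := C' ⊓ N with hC
  have hdisj : ∀ (w : W) (y : C), j w + y = 0 → w = 0 ∧ y = 0 := by
    intro w y hwy
    have h1 : j w = -(y : V) := eq_neg_of_add_eq_zero_left hwy
    have h2 : (y : V) ∈ LinearMap.range j ⊓ N :=
      ⟨⟨-w, by rw [map_neg, h1, neg_neg]⟩, y.2.2⟩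
    have h3 : (y : V) = 0 := Submodule.disjoint_def.mp hC'.disjoint _ h2 y.2.1
    refine ⟨hj ?_, Subtype.ext h3⟩
    rw [h1, h3, neg_zero, map_zero]
  have hsup : ∀ n ∈ N, ∃ (w : W) (y : C), n = j w + y := by
    intro n hn
    have : n ∈ (LinearMap.range j ⊓ N) ⊔ C' := hC'.sup_eq_top ▸ Submodule.mem_top
    obtain ⟨_, ⟨⟨w, rfl⟩, haN⟩, d, hd, rfl⟩ := Submodule.mem_sup.mp this
    exact ⟨w, ⟨d, hd, (Submodule.add_mem_iff_right N haN).mp hn⟩, rfl⟩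
  set φ : W × C →ₗ[K] V := j.coprod C.subtype with hφ
  have hφinj : LinearMap.ker φ = ⊥ := by
    rw [LinearMap.ker_eq_bot']
    rintro ⟨w, y⟩ hwy
    obtain ⟨rfl, rfl⟩ := hdisj w y hwy
    rfl
  obtain ⟨g, hg⟩ := φ.exists_leftInverse_of_injective hφinj
  -- The extension is `c` plus the correction `k'` with values in `N`, which is prescribed on
  -- `W ⊕ C` and extended along a linear retraction `g` of `V` onto `W ⊕ C`.
  set k' : W × C →ₗ[K] V := (j ∘ₗ τ.toLinearMap - c.toLinearMap ∘ₗ j).coprod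
    (C.subtype - c.toLinearMap ∘ₗ C.subtype) with hk'
  have hk'N : ∀ p, k' p ∈ N := by
    rintro ⟨w, y⟩
    exact N.add_mem (hτ w) (N.sub_mem y.2.2 ((hcN _).mpr y.2.2))
  have hgφ : ∀ p, g (φ p) = p := fun p => LinearMap.congr_fun hg p
  set σ : V →ₗ[K] V := c.toLinearMap + k' ∘ₗ g with hσ
  have hσN : ∀ v, σ v - c v ∈ N := by
    intro v
    simp only [hσ, LinearMap.add_apply, LinearEquiv.coe_coe, add_sub_cancel_left]
    exact hk'N _
  have hσφ : ∀ (w : W) (y : C), σ (j w + y) = j (τ w) + y := by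
    intro w y
    have h1 := hgφ (w, y)
    have h2 : φ (w, y) = j w + y := rfl
    have h3 : k' (w, y) = (j (τ w) - c (j w)) + (y - c y) := rfl
    rw [h2] at h1
    rw [hσ, LinearMap.add_apply, LinearMap.comp_apply, h1, h3, LinearEquiv.coe_coe, map_add]
    abel
  have hσj : ∀ w, σ (j w) = j (τ w) := by
    intro w
    simpa using hσφ w 0
  have hinj : Function.Injective σ := by
    rw [injective_iff_map_eq_zero]
    intro v hv
    have h1 := hσN v
    rw [hv, zero_sub, Submodule.neg_mem_iff, hcN] at h1
    obtain ⟨w, y, rfl⟩ := hsup v h1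
    rw [hσφ] at hv
    obtain ⟨h2, h3⟩ := hdisj _ _ hv
    rw [(LinearEquiv.map_eq_zero_iff τ).mp h2, h3, map_zero, Submodule.coe_zero, add_zero]
  have hsurj : Function.Surjective σ := by
    intro y
    obtain ⟨w, z, hwz⟩ := hsup _ (hσN (c.symm y))
    refine ⟨c.symm y - (j (τ.symm w) + z), ?_⟩
    rw [map_sub, hσφ, LinearEquiv.apply_symm_apply, ← hwz, LinearEquiv.apply_symm_apply,
      sub_sub_cancel]
  exact ⟨LinearEquiv.ofBijective σ ⟨hinj, hsurj⟩, hσj, hσN⟩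

/-! ### Bounded operators that restrict to operators of order zero -/

section Extension

variable {H : Type*} [NormedAddCommGroup H] [InnerProductSpace ℂ H] {ι : Type*}
  {b : HilbertBasis ι ℂ H} {Δ : H →ₗ.[ℂ] H} {lam : ι → ℝ}

lemma Restricts.unique_left (h : LapDiag b Δ lam) {T T' : H →L[ℂ] H} {X : SmoothEnd Δ}
    (hT : Restricts T X) (hT' : Restricts T' X) : T = T' := by
  refine ContinuousLinearMap.ext fun v => ?_
  refine congrFun (T.continuous.ext_on h.dense_smooth T'.continuous fun w hw => ?_) v
  rw [← hT ⟨w, hw⟩, ← hT' ⟨w, hw⟩]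

lemma Restricts.unique_right {T : H →L[ℂ] H} {X X' : SmoothEnd Δ} (hX : Restricts T X)
    (hX' : Restricts T X') : X = X' :=
  LinearMap.ext fun v => Subtype.ext ((hX v).trans (hX' v).symm)

lemma Restricts.add {T T' : H →L[ℂ] H} {X X' : SmoothEnd Δ} (hX : Restricts T X)
    (hX' : Restricts T' X') : Restricts (T + T') (X + X') := fun v => by
  rw [LinearMap.add_apply, Submodule.coe_add, hX v, hX' v, add_apply]

lemma Restricts.smul (c : ℂ) {T : H →L[ℂ] H} {X : SmoothEnd Δ} (hX : Restricts T X) :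
    Restricts (c • T) (c • X) := fun v => by
  rw [LinearMap.smul_apply, Submodule.coe_smul, hX v, smul_apply]

lemma Restricts.mul {T T' : H →L[ℂ] H} {X X' : SmoothEnd Δ} (hX : Restricts T X)
    (hX' : Restricts T' X') : Restricts (T * T') (X * X') := fun v => by
  rw [Module.End.mul_apply, hX, hX']
  rfl

/-- The algebra of the bounded operators on `H` that restrict to operators of order zero. -/
def LapDiag.boundedAlg (h : LapDiag b Δ lam) : Subalgebra ℂ (H →L[ℂ] H) where
  carrier := {T | ∃ X : SmoothEnd Δ, IsOp Δ 2 0 X ∧ Restricts T X}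
  mul_mem' := fun ⟨X, hX, hX'⟩ ⟨Y, hY, hY'⟩ =>
    ⟨X * Y, by simpa using hX.mul hY, hX'.mul hY'⟩
  add_mem' := fun ⟨X, hX, hX'⟩ ⟨Y, hY, hY'⟩ => ⟨X + Y, hX.add hY, hX'.add hY'⟩
  algebraMap_mem' := fun c => ⟨c • 1, h.isOp_one.smul c, by
    rw [Algebra.algebraMap_eq_smul_one]
    exact Restricts.smul c fun v => rfl⟩

variable [CompleteSpace H]

lemma IsOp.exists_restricts (h : LapDiag b Δ lam) {X : SmoothEnd Δ} (hX : IsOp Δ 2 0 X) :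
    ∃ T : H →L[ℂ] H, Restricts T X := by
  obtain ⟨C, hC⟩ := hX.mapsSob (sub_zero 0)
  simp only [h.sobNorm_zero] at hC
  set f : smooth Δ →L[ℂ] H := LinearMap.mkContinuous ((smooth Δ).subtype ∘ₗ X) C hC with hf
  refine ⟨f.extend (smooth Δ).subtypeL, fun v => ?_⟩
  exact (ContinuousLinearMap.extend_eq f h.dense_smooth.denseRange_val
    isUniformEmbedding_subtype_val.isUniformInducing v).symm

/-- The continuous extension to `H` of an operator of order zero on `H^∞`. -/
def LapDiag.extendOp (h : LapDiag b Δ lam) (X : opFil Δ 0) : H →L[ℂ] H :=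
  (X.2.exists_restricts h).choose

lemma LapDiag.restricts_extendOp (h : LapDiag b Δ lam) (X : opFil Δ 0) :
    Restricts (h.extendOp X) (X : SmoothEnd Δ) :=
  (X.2.exists_restricts h).choose_spec

/-- Extension by continuity identifies the operators of order zero on `H^∞` with the bounded
operators on `H` that restrict to such operators. -/
def LapDiag.extendEquiv (h : LapDiag b Δ lam) : opFil Δ 0 ≃ₗ[ℂ] h.boundedAlg :=
  LinearEquiv.ofBijective
    ({ toFun := fun X => ⟨h.extendOp X, X, X.2, h.restricts_extendOp X⟩
       map_add' := fun X Y => Subtype.ext (Restricts.unique_left h (h.restricts_extendOp (X + Y))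
        ((h.restricts_extendOp X).add (h.restricts_extendOp Y)))
       map_smul' := fun c X => Subtype.ext (Restricts.unique_left h (h.restricts_extendOp (c • X))
        ((h.restricts_extendOp X).smul c)) } : opFil Δ 0 →ₗ[ℂ] h.boundedAlg)
    ⟨fun X Y hXY => by
      have h1 : h.extendOp X = h.extendOp Y := congrArg Subtype.val hXY
      have h2 := h.restricts_extendOp X
      rw [h1] at h2
      exact Subtype.ext (h2.unique_right (h.restricts_extendOp Y)),
    fun ⟨T, X, hX, hT⟩ => ⟨⟨X, hX⟩, Subtype.ext
      (Restricts.unique_left h (h.restricts_extendOp ⟨X, hX⟩) hT)⟩⟩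

lemma LapDiag.restricts_extendEquiv (h : LapDiag b Δ lam) (X : opFil Δ 0) :
    Restricts (h.extendEquiv X : H →L[ℂ] H) (X : SmoothEnd Δ) :=
  h.restricts_extendOp X

lemma LapDiag.extendEquiv_eq (h : LapDiag b Δ lam) {X : SmoothEnd Δ} (hX : IsOp Δ 2 0 X)
    {T : H →L[ℂ] H} (hT : Restricts T X) : (h.extendEquiv ⟨X, hX⟩ : H →L[ℂ] H) = T :=
  Restricts.unique_left h (h.restricts_extendEquiv _) hT

end Extension

/-! ### The operator `|D|` on `H^∞` -/

section Abs

variable {H : Type*} [NormedAddCommGroup H] [InnerProductSpace ℂ H] {ι : Type*}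
  {b : HilbertBasis ι ℂ H} {D Δ : H →ₗ.[ℂ] H} {x : ι → ℝ}

lemma isDiag_absOp (hD : IsDiag b D fun i => (x i : ℂ)) :
    IsDiag b (absOp D) fun i => ((|x i| : ℝ) : ℂ) :=
  hD.funCalc fun y => ((|y| : ℝ) : ℂ)

lemma absOp_restr_coord (hD : IsDiag b D fun i => (x i : ℂ))
    (h : LapDiag b Δ fun i => x i ^ 2 + 1) (v : smooth Δ) (i : ι) :
    ⟪b i, (restr (smooth Δ) (absOp D) v : H)⟫_ℂ = ((|x i| : ℝ) : ℂ) * ⟪b i, (v : H)⟫_ℂ := by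
  refine h.restr_coord (C := 1) (n := 1) (isDiag_absOp hD) (fun i => ?_) v i
  rw [Complex.norm_real, Real.norm_eq_abs, abs_abs, one_mul, pow_one, ← sq_abs (x i)]
  nlinarith [sq_nonneg (|x i| - 1), abs_nonneg (x i)]

/-- The difference of `Λ = (D² + 1) ^ (1 / 2)` and `|D|` has order zero. -/
lemma isOp_sobPow_sub_absOp (hD : IsDiag b D fun i => (x i : ℂ))
    (h : LapDiag b Δ fun i => x i ^ 2 + 1) :
    IsOp Δ 2 0 (sobPow Δ 1 - restr (smooth Δ) (absOp D)) := by
  intro s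
  refine ⟨1, fun v => ?_⟩
  rw [one_mul, sub_zero]
  refine norm_le_of_coord b fun i => ?_
  rw [h.powOp_coord, h.powOp_coord, norm_mul, norm_mul]
  gcongr
  rw [LinearMap.sub_apply, Submodule.coe_sub, inner_sub_right, h.powOp_coord,
    absOp_restr_coord hD h, ← sub_mul, norm_mul]
  refine mul_le_of_le_one_left (norm_nonneg _) ?_
  have h1 : ((x i ^ 2 + 1 : ℝ) : ℂ) ^ ((1 : ℂ) / (2 : ℕ)) = (√(x i ^ 2 + 1) : ℝ) := by
    rw [Real.sqrt_eq_rpow, Complex.ofReal_cpow (h.pos i).le]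
    push_cast
    rfl
  rw [h1, ← Complex.ofReal_sub, Complex.norm_real, Real.norm_eq_abs, abs_le]
  constructor
  · have : |x i| ≤ √(x i ^ 2 + 1) := Real.abs_le_sqrt (by linarith)
    linarith
  · rw [sub_le_iff_le_add, Real.sqrt_le_left (by positivity)]
    nlinarith [abs_nonneg (x i), sq_abs (x i)]

lemma isOp_absOp (hD : IsDiag b D fun i => (x i : ℂ)) (h : LapDiag b Δ fun i => x i ^ 2 + 1) :
    IsOp Δ 2 1 (restr (smooth Δ) (absOp D)) := by
  have h1 := (h.isOp_sobPow 1).sub ((isOp_sobPow_sub_absOp hD h).mono h zero_le_one)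
  rwa [sub_sub_cancel] at h1

/-- A commutation relation with `|D|` on `H^∞` extends to the domain of `|D|`, since this operator
is closed and `H^∞` is a core. -/
lemma abs_relation_extends {D Δ : H →ₗ.[ℂ] H} (hD : IsDiag b D fun i => (x i : ℂ))
    (h : LapDiag b Δ fun i => x i ^ 2 + 1) {T T' C : H →L[ℂ] H} {X X' Y : SmoothEnd Δ}
    (hT : Restricts T X) (hT' : Restricts T' X') (hC : Restricts C Y)
    (hY : restr (smooth Δ) (absOp D) * X = X' * restr (smooth Δ) (absOp D) + Y) {v w : H}
    (hvw : ∀ i, ⟪b i, w⟫_ℂ = ((|x i| : ℝ) : ℂ) * ⟪b i, v⟫_ℂ) (i : ι) :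
    ⟪b i, T' w + C v⟫_ℂ = ((|x i| : ℝ) : ℂ) * ⟪b i, T v⟫_ℂ := by
  classical
  have hF : ∀ F, ⟪b i, T' (h.trunc F w : H) + C (h.trunc F v : H)⟫_ℂ =
      ((|x i| : ℝ) : ℂ) * ⟪b i, T (h.trunc F v : H)⟫_ℂ := by
    intro F
    have h1 : restr (smooth Δ) (absOp D) (h.trunc F v) = h.trunc F w := by
      refine h.smooth_ext fun k => ?_
      rw [absOp_restr_coord hD h, h.coord_trunc, h.coord_trunc, hvw, mul_ite, mul_zero]
    rw [← h1, ← hT', ← hC, ← hT, ← absOp_restr_coord hD h, ← Submodule.coe_add]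
    have h2 := LinearMap.congr_fun hY (h.trunc F v)
    rw [Module.End.mul_apply, LinearMap.add_apply, Module.End.mul_apply] at h2
    rw [h2]
  have hv := h.tendsto_trunc v
  have hw := h.tendsto_trunc w
  have l1 : Filter.Tendsto (fun F => ⟪b i, T' (h.trunc F w : H) + C (h.trunc F v : H)⟫_ℂ)
      Filter.atTop (nhds ⟪b i, T' w + C v⟫_ℂ) :=
    tendsto_const_nhds.inner (((T'.continuous.tendsto w).comp hw).add
      ((C.continuous.tendsto v).comp hv))
  have l2 : Filter.Tendsto (fun F => ((|x i| : ℝ) : ℂ) * ⟪b i, T (h.trunc F v : H)⟫_ℂ)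
      Filter.atTop (nhds (((|x i| : ℝ) : ℂ) * ⟪b i, T v⟫_ℂ)) :=
    (tendsto_const_nhds.inner ((T.continuous.tendsto v).comp hv)).const_mul _
  exact tendsto_nhds_unique (l1.congr hF) l2

end Abs

/-! ### Twistings of the algebra of all operators of finite order -/

section Twisting

variable {H : Type*} [NormedAddCommGroup H] [InnerProductSpace ℂ H] {ι : Type*}
  {b : HilbertBasis ι ℂ H} {Δ : H →ₗ.[ℂ] H} {lam : ι → ℝ}

/-- A linear map to operators of order zero, as a map to `Op`. -/
def LapDiag.toOpAlg (h : LapDiag b Δ lam) {W : Type*} [AddCommGroup W] [Module ℂ W]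
    (j : W →ₗ[ℂ] SmoothEnd Δ) (hop : ∀ w, IsOp Δ 2 0 (j w)) : W →ₗ[ℂ] h.opAlg where
  toFun := fun w => ⟨j w, 0, hop w⟩
  map_add' := fun v w => Subtype.ext (map_add j v w)
  map_smul' := fun c w => Subtype.ext (map_smul j c w)

/-- A space `W` of operators of order zero with a linear automorphism `τ` such that
`Λ X - τ(X) Λ` has order zero for `X ∈ W`: then `τ` extends to a linear automorphism of `Op` that
agrees with conjugation by `Λ` up to operators of order `-1`. -/
theorem LapDiag.exists_twisting (h : LapDiag b Δ lam) {W : Type*} [AddCommGroup W] [Module ℂ W]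
    (j : W →ₗ[ℂ] SmoothEnd Δ) (hj : Function.Injective j) (τ : W ≃ₗ[ℂ] W)
    (hop : ∀ w, IsOp Δ 2 0 (j w))
    (hτ : ∀ w, IsOp Δ 2 0 (sobPow Δ 1 * j w - j (τ w) * sobPow Δ 1)) :
    ∃ σ : h.opAlg ≃ₗ[ℂ] h.opAlg, (∀ w, (σ ⟨j w, 0, hop w⟩ : SmoothEnd Δ) = j (τ w)) ∧
      ∀ T : h.opAlg, IsOp Δ 2 (-1) ((σ T : SmoothEnd Δ) - (h.opConj 1 T : SmoothEnd Δ)) := by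
  obtain ⟨σ, hσ, hσN⟩ := exists_linearEquiv_extend (h.opConj 1).toLinearEquiv
    ((opFil Δ (-1)).comap (Subalgebra.toSubmodule h.opAlg).subtype)
    (fun T => h.isOp_opConj_iff 1) (h.toOpAlg j hop)
    (fun v w hvw => hj (congrArg (fun T : h.opAlg => (T : SmoothEnd Δ)) hvw)) τ
    (fun w => by
      have h1 := h.isOp_sobPow (-1)
      rw [Complex.neg_re, Complex.one_re] at h1
      have h2 := (hτ w).mul h1
      rw [zero_add, sub_mul, mul_assoc (j (τ w)), h.sobPow_mul_neg, mul_one] at h2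
      exact h2.sub_symm)
  exact ⟨σ, fun w => congrArg (fun T : h.opAlg => (T : SmoothEnd Δ)) (hσ w), hσN⟩

end Twisting

section Triple

variable {A H : Type*} [Ring A] [StarRing A] [Algebra ℂ A] [StarModule ℂ A]
  [NormedAddCommGroup H] [InnerProductSpace ℂ H] [CompleteSpace H] {ι : Type*}
  {b : HilbertBasis ι ℂ H} {x : ι → ℝ}

lemma TwistedSpectralTriple.lapDiag (S : TwistedSpectralTriple A H)
    (hD : IsDiag b S.D fun i => (x i : ℂ)) : LapDiag b S.lap fun i => x i ^ 2 + 1 where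
  diag := by
    have h1 := (hD.pcomp hD fun i => by
      rw [norm_mul]
      nlinarith [norm_nonneg (x i : ℂ), sq_nonneg (‖(x i : ℂ)‖ - 1)]).id_vadd
    have h2 : ∀ i, (x i : ℂ) * x i + 1 = ((x i ^ 2 + 1 : ℝ) : ℂ) := fun i => by
      push_cast
      ring
    simp only [h2] at h1
    exact h1
  one_le := fun i => by nlinarith [sq_nonneg (x i)]

variable {lam : ι → ℝ}

/-- A linear automorphism of the algebra `Op` that extends the twisting of `A` and agrees with
conjugation by `Λ = Δ ^ (1 / 2)` up to operators of order `-1`, the elements of `A` and `[D, A]_θ`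
being of order zero. Such a twisting amounts to regularity. -/
structure OpTwisting (S : TwistedSpectralTriple A H) (h : LapDiag b S.lap lam) where
  /-- the linear automorphism of `Op` -/
  σ : h.opAlg ≃ₗ[ℂ] h.opAlg
  sub_conj : ∀ T : h.opAlg,
    IsOp S.lap 2 (-1) ((σ T : SmoothEnd S.lap) - (h.opConj 1 T : SmoothEnd S.lap))
  alg : ∀ a, ∃ X : h.opAlg, IsOp S.lap 2 0 (X : SmoothEnd S.lap) ∧
    Restricts (S.π a) (X : SmoothEnd S.lap) ∧ Restricts (S.π (S.θ a)) (σ X : SmoothEnd S.lap)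
  comm : ∀ (a : A) (T : H →L[ℂ] H), S.IsComm a T →
    ∃ X : SmoothEnd S.lap, IsOp S.lap 2 0 X ∧ Restricts T X

namespace OpTwisting

variable {S : TwistedSpectralTriple A H} {h : LapDiag b S.lap lam} (Θ : OpTwisting S h)

lemma isOp_iff {t : ℝ} (ht : -1 ≤ t) (X : h.opAlg) :
    IsOp S.lap 2 t (Θ.σ X : SmoothEnd S.lap) ↔ IsOp S.lap 2 t (X : SmoothEnd S.lap) := by
  have h1 := (Θ.sub_conj X).mono h ht
  rw [← h.isOp_opConj_iff 1 (T := X)]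
  constructor
  · intro h2
    have := h2.sub h1
    rwa [sub_sub_cancel] at this
  · intro h2
    have := h1.add h2
    rwa [sub_add_cancel] at this

lemma isOp_comm (X : h.opAlg) : IsOp S.lap 2 0
    (sobPow S.lap 1 * (X : SmoothEnd S.lap) - (Θ.σ X : SmoothEnd S.lap) * sobPow S.lap 1) := by
  have h1 := h.isOp_sobPow 1
  rw [Complex.one_re] at h1
  have h2 := (Θ.sub_conj X).mul h1
  rw [neg_add_cancel, sub_mul, h.opConj_mul_sobPow] at h2
  exact h2.sub_symm

/-- The full algebra `Op` as a twisted algebra of pseudodifferential operators, twisted by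
conjugation with the complex powers of `Δ`. -/
def psiDO (h : LapDiag b S.lap lam) : TwistedPsiDOAlgebra S.lap 2 where
  carrier := h.opAlg
  carrier_op := fun P hP => hP
  fil := opFil S.lap
  fil_mono := fun s t hst T hT => IsOp.mono h hst hT
  fil_one := h.isOp_one
  fil_mul := fun s t P hP Q hQ => IsOp.mul hP hQ
  fil_exhaust := h.iSup_opFil
  Θ := h.opConj
  Θ_add := h.opConj_add
  Θ_fil := fun z t P hP => h.isOp_opConj z hP
  pow_mul_mem := fun z t P hP => (h.isOp_sobPow z).mul hP
  mul_pow_mem := fun z t P hP => IsOp.mul hP (h.isOp_sobPow z)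
  comm_mem := fun z t P hP => by
    rw [h.opConj_mul_sobPow, sub_self]
    exact Submodule.zero_mem _
  fil_zero_op := fun P hP => hP

include Θ in
lemma psiDO_compatible : (psiDO h).Compatible := by
  intro a
  obtain ⟨X, hX, hXa, hXθ⟩ := Θ.alg a
  exact ⟨X, Θ.σ X, hX, hXa, hXθ, (Θ.sub_conj X).sub_symm⟩

/-- The operators of finite order, filtered by the integral orders `m ≥ 0`, as a twisted algebra of
differential operators. -/
def doAlgebra : TwistedDOAlgebra S.lap 2 where
  carrier := h.opAlg
  fil := fun m => opFil S.lap m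
  fil_mono := fun m n hmn T hT => IsOp.mono h (Nat.cast_le.mpr hmn) hT
  fil_one := by
    rw [Nat.cast_zero]
    exact h.isOp_one
  fil_mul := fun m n X hX Y hY => by
    rw [Nat.cast_add]
    exact IsOp.mul hX hY
  fil_exhaust := by
    rw [← h.iSup_opFil]
    refine le_antisymm (iSup_le fun m => le_iSup (opFil S.lap) (m : ℝ)) (iSup_le fun t => ?_)
    exact le_trans (fun T hT => IsOp.mono h (Nat.le_ceil t) hT)
      (le_iSup (fun m : ℕ => opFil S.lap (m : ℝ)) ⌈t⌉₊)
  θ := Θ.σ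
  θ_fil := fun m X => Θ.isOp_iff (by linarith [m.cast_nonneg (α := ℝ)]) X
  nabla_mem := fun m X _ => by
    -- `θ²` agrees with conjugation by `Λ² = Δ` up to order `-1`.
    have h1 := h.isOp_opConj 1 (T := Θ.σ X - h.opConj 1 X) (t := -1) (Θ.sub_conj X)
    have h2 := h1.add (Θ.sub_conj (Θ.σ X))
    have h3 := h.isOp_sobPow 2
    rw [Complex.re_ofNat] at h3
    have e : (h.opConj 1 (Θ.σ X - h.opConj 1 X) : SmoothEnd S.lap) +
        ((Θ.σ (Θ.σ X) : SmoothEnd S.lap) - (h.opConj 1 (Θ.σ X) : SmoothEnd S.lap)) =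
        ((Θ.σ ^ 2) X : SmoothEnd S.lap) - (h.opConj 2 X : SmoothEnd S.lap) := by
      rw [map_sub (h.opConj 1), Subalgebra.coe_sub, ← h.opConj_add, one_add_one_eq_two, pow_two,
        LinearEquiv.mul_apply]
      abel
    rw [e] at h2
    have h4 := h2.sub_symm.mul h3
    rw [sub_mul, h.opConj_mul_sobPow, h.sobPow_two] at h4
    refine IsOp.mono h ?_ h4
    have : m + 2 - 1 = m + 1 := rfl
    rw [this]
    push_cast
    linarith [m.cast_nonneg (α := ℝ)]
  elliptic := fun m X hX => by
    obtain ⟨C, hC, hX'⟩ := (IsOp.mapsSob hX (sub_self (m : ℝ))).exists_pos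
    refine ⟨C, hC, fun v => ?_⟩
    have := hX' v
    rw [h.sobNorm_zero] at this
    exact this

lemma doAlgebra_compatible : Θ.doAlgebra.Compatible := by
  intro a
  obtain ⟨X, hX, hXa, hXθ⟩ := Θ.alg a
  refine ⟨X, ?_, hXa, hXθ⟩
  change IsOp S.lap 2 ((0 : ℕ) : ℝ) _
  rwa [Nat.cast_zero]

lemma doAlgebra_containsComm : Θ.doAlgebra.ContainsComm := by
  intro a T hT
  obtain ⟨X, hX, hXT⟩ := Θ.comm a T hT
  refine ⟨X, ?_, hXT⟩
  change IsOp S.lap 2 ((0 : ℕ) : ℝ) _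
  rwa [Nat.cast_zero]

/-- The twisting restricted to the operators of order zero. -/
def zeroEquiv : opFil S.lap 0 ≃ₗ[ℂ] opFil S.lap 0 where
  toFun := fun X => ⟨Θ.σ ⟨X, 0, X.2⟩, (Θ.isOp_iff (by norm_num) _).mpr X.2⟩
  invFun := fun X => ⟨Θ.σ.symm ⟨X, 0, X.2⟩, (Θ.isOp_iff (by norm_num) _).mp (by
    rw [LinearEquiv.apply_symm_apply]
    exact X.2)⟩
  map_add' := fun X Y => Subtype.ext (congrArg (fun T : h.opAlg => (T : SmoothEnd S.lap))
    (map_add Θ.σ ⟨(X : SmoothEnd S.lap), 0, X.2⟩ ⟨(Y : SmoothEnd S.lap), 0, Y.2⟩))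
  map_smul' := fun c X => Subtype.ext (congrArg (fun T : h.opAlg => (T : SmoothEnd S.lap))
    (map_smul Θ.σ c ⟨(X : SmoothEnd S.lap), 0, X.2⟩))
  left_inv := fun X => Subtype.ext (congrArg (fun T : h.opAlg => (T : SmoothEnd S.lap))
    (Θ.σ.symm_apply_apply ⟨(X : SmoothEnd S.lap), 0, X.2⟩))
  right_inv := fun X => Subtype.ext (congrArg (fun T : h.opAlg => (T : SmoothEnd S.lap))
    (Θ.σ.apply_symm_apply ⟨(X : SmoothEnd S.lap), 0, X.2⟩))

end OpTwisting

/-- A twisting of `Op` yields regularity, with `B` the algebra of the bounded operators that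
restrict to operators of order zero. -/
theorem OpTwisting.isRegular {S : TwistedSpectralTriple A H} (hD : IsDiag b S.D fun i => (x i : ℂ))
    {h : LapDiag b S.lap fun i => x i ^ 2 + 1} (Θ : OpTwisting S h) : S.IsRegular := by
  refine ⟨h.boundedAlg, h.extendEquiv.symm.trans (Θ.zeroEquiv.trans h.extendEquiv), ?_, ?_, ?_⟩
  · intro a
    obtain ⟨X, hX, hXa, hXθ⟩ := Θ.alg a
    refine ⟨h.extendEquiv ⟨X, hX⟩, h.extendEquiv_eq hX hXa, ?_⟩
    rw [LinearEquiv.trans_apply, LinearEquiv.symm_apply_apply]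
    exact h.extendEquiv_eq _ hXθ
  · exact Θ.comm
  intro β
  obtain ⟨X, rfl⟩ := h.extendEquiv.surjective β
  rw [LinearEquiv.trans_apply, LinearEquiv.symm_apply_apply, LinearEquiv.trans_apply]
  set X' := Θ.zeroEquiv X with hX'
  set M := restr (smooth S.lap) (absOp S.D) with hM
  -- `|D| X - θ(X) |D|` differs from `Λ X - θ(X) Λ` by operators of order zero.
  have hR := isOp_sobPow_sub_absOp hD h
  have hY : IsOp S.lap 2 0 (M * (X : SmoothEnd S.lap) - (X' : SmoothEnd S.lap) * M) := by
    have h1 := ((Θ.isOp_comm ⟨X, 0, X.2⟩).sub (by simpa using hR.mul X.2)).add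
      (by simpa using IsOp.mul X'.2 hR)
    convert h1 using 1
    change _ = sobPow S.lap 1 * (X : SmoothEnd S.lap) - (X' : SmoothEnd S.lap) * sobPow S.lap 1 -
      (sobPow S.lap 1 - M) * (X : SmoothEnd S.lap) +
      (X' : SmoothEnd S.lap) * (sobPow S.lap 1 - M)
    rw [sub_mul, mul_sub]
    abel
  set Y : opFil S.lap 0 := ⟨_, hY⟩ with hYdef
  have hdiag := isDiag_absOp hD
  have key : ∀ v w : H, (∀ i, ⟪b i, w⟫_ℂ = ((|x i| : ℝ) : ℂ) * ⟪b i, v⟫_ℂ) → ∀ i,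
      ⟪b i, (h.extendEquiv X' : H →L[ℂ] H) w + (h.extendEquiv Y : H →L[ℂ] H) v⟫_ℂ =
        ((|x i| : ℝ) : ℂ) * ⟪b i, (h.extendEquiv X : H →L[ℂ] H) v⟫_ℂ := fun v w hvw =>
    abs_relation_extends hD h (h.restricts_extendEquiv X) (h.restricts_extendEquiv X')
      (h.restricts_extendEquiv Y) (add_sub_cancel _ _).symm hvw
  refine ⟨h.extendEquiv Y, (h.extendEquiv Y).2, le_antisymm inf_le_left fun v hv => ?_,
    fun v => ?_⟩
  · obtain ⟨w, hw⟩ := hdiag.domain_iff.mp hv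
    exact ⟨hv, hdiag.domain_iff.mpr ⟨_, key v w hw⟩⟩
  · refine ext_coord b fun i => ?_
    have h1 := key v (absOp S.D ⟨v, v.2.1⟩) (fun i => hdiag.apply ⟨v, v.2.1⟩ i) i
    have h2 := hdiag.apply ⟨_, v.2.2⟩ i
    change ⟪b i, absOp S.D ⟨_, v.2.2⟩ - (h.extendEquiv X' : H →L[ℂ] H)
      (absOp S.D ⟨v, v.2.1⟩)⟫_ℂ = _
    rw [inner_sub_right, h2, sub_eq_iff_eq_add, ← inner_add_right, add_comm]
    exact h1.symm

end Triple

/-! ### Algebras of bounded operators invariant under twisted commutators with `|D|` -/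

section Regular

variable {H : Type*} [NormedAddCommGroup H] [InnerProductSpace ℂ H] {ι : Type*}
  {b : HilbertBasis ι ℂ H} {D Δ : H →ₗ.[ℂ] H} {x : ι → ℝ}

/-- The relation `|D| β = σ(β) |D| + γ(β)` for `β ∈ B`, in coordinates: as `|D|` is diagonal with
eigenvalues `|x i|`, the vector `w` is `|D| v`. -/
def AbsCommutes (b : HilbertBasis ι ℂ H) (x : ι → ℝ) {B : Subalgebra ℂ (H →L[ℂ] H)}
    (σ : B ≃ₗ[ℂ] B) (γ : B → B) : Prop :=
  ∀ (β : B) (v w : H), (∀ i, ⟪b i, w⟫_ℂ = ((|x i| : ℝ) : ℂ) * ⟪b i, v⟫_ℂ) →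
    ∀ i, ⟪b i, (σ β : H →L[ℂ] H) w + (γ β : H →L[ℂ] H) v⟫_ℂ =
      ((|x i| : ℝ) : ℂ) * ⟪b i, (β : H →L[ℂ] H) v⟫_ℂ

/-- `H^∞` is the intersection of the domains of the powers of `|D|`. -/
lemma LapDiag.mem_smooth_iff_abs (h : LapDiag b Δ fun i => x i ^ 2 + 1) {v : H} :
    v ∈ smooth Δ ↔
      ∀ n : ℕ, ∃ w : H, ∀ i, ⟪b i, w⟫_ℂ = ((|x i| : ℝ) : ℂ) ^ n * ⟪b i, v⟫_ℂ := by
  constructor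
  · intro hv n
    obtain ⟨w, -, hw⟩ := h.exists_coord_smooth (c := fun i => ((|x i| : ℝ) : ℂ) ^ n) (C := 1)
      (n := n) (fun i => by
        rw [norm_pow, Complex.norm_real, Real.norm_eq_abs, abs_abs, one_mul]
        refine pow_le_pow_left₀ (abs_nonneg _) ?_ n
        nlinarith [sq_nonneg (|x i| - 1), abs_nonneg (x i), sq_abs (x i)]) ⟨v, hv⟩
    exact ⟨w, hw⟩
  · intro hv
    rw [h.mem_smooth]
    intro n
    obtain ⟨w, hw⟩ := hv (2 * n)
    refine exists_coord_of_le b (v := ((2 : ℂ) ^ n) • w) (w := ((2 : ℂ) ^ n) • v) fun i => ?_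
    rw [inner_smul_right, inner_smul_right, hw, norm_mul, norm_mul, norm_mul, norm_mul, norm_pow,
      norm_pow, norm_pow, Complex.norm_real, Complex.norm_real, Real.norm_of_nonneg (h.pos i).le,
      Real.norm_eq_abs, abs_abs, Complex.norm_ofNat, pow_mul, sq_abs, ← mul_assoc, ← add_mul]
    gcongr
    calc (x i ^ 2 + 1) ^ n ≤ 2 ^ (n - 1) * ((x i ^ 2) ^ n + 1 ^ n) :=
          add_pow_le (sq_nonneg _) zero_le_one n
      _ ≤ 2 ^ n * ((x i ^ 2) ^ n + 1 ^ n) := by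
          gcongr
          · norm_num
          · exact n.sub_le 1
      _ = 2 ^ n * (x i ^ 2) ^ n + 2 ^ n := by rw [one_pow, mul_add, mul_one]

namespace AbsCommutes

variable {B : Subalgebra ℂ (H →L[ℂ] H)} {σ : B ≃ₗ[ℂ] B} {γ : B → B}

/-- Elements of `B` preserve the domains of the powers of `|D|`. -/
lemma exists_coord_pow (hγ : AbsCommutes b x σ γ) (n : ℕ) (β : B) {v : H}
    (hv : ∀ k ≤ n, ∃ w : H, ∀ i, ⟪b i, w⟫_ℂ = ((|x i| : ℝ) : ℂ) ^ k * ⟪b i, v⟫_ℂ) :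
    ∃ w : H, ∀ i, ⟪b i, w⟫_ℂ = ((|x i| : ℝ) : ℂ) ^ n * ⟪b i, (β : H →L[ℂ] H) v⟫_ℂ := by
  induction n generalizing β v with
  | zero => exact ⟨(β : H →L[ℂ] H) v, fun i => by rw [pow_zero, one_mul]⟩
  | succ n ih =>
    obtain ⟨u, hu⟩ := hv 1 (Nat.le_add_left 1 n)
    simp only [pow_one] at hu
    obtain ⟨w₁, hw₁⟩ := ih (σ β) (v := u) fun k hk => by
      obtain ⟨w, hw⟩ := hv (k + 1) (Nat.succ_le_succ hk)
      exact ⟨w, fun i => by rw [hw, hu, pow_succ, mul_assoc]⟩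
    obtain ⟨w₂, hw₂⟩ := ih (γ β) (v := v) fun k hk => hv k (hk.trans n.le_succ)
    refine ⟨w₁ + w₂, fun i => ?_⟩
    rw [inner_add_right, hw₁, hw₂, ← mul_add, ← inner_add_right, hγ β v u hu i, pow_succ, mul_assoc]

lemma map_mem_smooth (hγ : AbsCommutes b x σ γ) (h : LapDiag b Δ fun i => x i ^ 2 + 1) (β : B)
    {v : H} (hv : v ∈ smooth Δ) : (β : H →L[ℂ] H) v ∈ smooth Δ :=
  h.mem_smooth_iff_abs.mpr fun n =>
    hγ.exists_coord_pow n β fun k _ => h.mem_smooth_iff_abs.mp hv k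

/-- The restriction to `H^∞` of the elements of `B`. -/
def restrict (hγ : AbsCommutes b x σ γ) (h : LapDiag b Δ fun i => x i ^ 2 + 1) :
    B →ₗ[ℂ] SmoothEnd Δ where
  toFun := fun β =>
    ((β : H →L[ℂ] H) : H →ₗ[ℂ] H).restrict fun _ hv => hγ.map_mem_smooth h β hv
  map_add' := fun _ _ => rfl
  map_smul' := fun _ _ => rfl

variable (hγ : AbsCommutes b x σ γ) (h : LapDiag b Δ fun i => x i ^ 2 + 1)

include hγ

lemma restricts_restrict (β : B) : Restricts (β : H →L[ℂ] H) (hγ.restrict h β) := fun _ => rfl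

lemma restrict_injective : Function.Injective (hγ.restrict h) := fun β β' hβ =>
  Subtype.ext (Restricts.unique_left h (hγ.restricts_restrict h β)
    (hβ ▸ hγ.restricts_restrict h β'))

lemma absOp_mul_restrict (hD : IsDiag b D fun i => (x i : ℂ)) (β : B) :
    restr (smooth Δ) (absOp D) * hγ.restrict h β =
      hγ.restrict h (σ β) * restr (smooth Δ) (absOp D) + hγ.restrict h (γ β) := by
  refine LinearMap.ext fun v => h.smooth_ext fun i => ?_
  rw [Module.End.mul_apply, absOp_restr_coord hD h, LinearMap.add_apply, Module.End.mul_apply,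
    Submodule.coe_add]
  exact (hγ β v _ (fun i => absOp_restr_coord hD h v i) i).symm

/-- Elements of `B` act on the Sobolev spaces of integral order `n ≥ 0`. -/
lemma mapsSob_natCast (hD : IsDiag b D fun i => (x i : ℂ)) (n : ℕ) (β : B) :
    MapsSob Δ n n (hγ.restrict h β) := by
  have hR := isOp_sobPow_sub_absOp hD h
  have hM := isOp_absOp hD h
  induction n generalizing β with
  | zero =>
    refine ⟨‖(β : H →L[ℂ] H)‖, fun v => ?_⟩
    rw [Nat.cast_zero, h.sobNorm_zero, h.sobNorm_zero]
    exact (β : H →L[ℂ] H).le_opNorm v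
  | succ n ih =>
    -- `β = Λ⁻¹ (σ(β) |D| + γ(β) + (Λ - |D|) β)`
    have h1 := (((ih (σ β)).mul (hM.mapsSob (s := (n : ℝ) + 1) (by ring))).add
      ((ih (γ β)).mono h (le_add_of_nonneg_right zero_le_one) le_rfl)).add
      (((hR.mapsSob (sub_zero (n : ℝ))).mul (ih β)).mono h
        (le_add_of_nonneg_right zero_le_one) le_rfl)
    rw [← hγ.absOp_mul_restrict h hD, ← add_mul, add_sub_cancel] at h1
    have h2 := (h.mapsSob_sobPow (z := -1) (s := n) (t := (n : ℝ) + 1) (by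
      rw [Complex.neg_re, Complex.one_re]; linarith)).mul h1
    rw [← mul_assoc, h.sobPow_neg_mul, one_mul] at h2
    rwa [Nat.cast_succ]

/-- Elements of `B` act on the Sobolev spaces of negative integral order; here the surjectivity of
the twisting of `B` is used. -/
lemma mapsSob_neg_natCast (hD : IsDiag b D fun i => (x i : ℂ)) (n : ℕ) (β : B) :
    MapsSob Δ (-n) (-n) (hγ.restrict h β) := by
  have hR := isOp_sobPow_sub_absOp hD h
  have hM := isOp_absOp hD h
  induction n generalizing β with
  | zero => simpa using hγ.mapsSob_natCast h hD 0 β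
  | succ n ih =>
    -- `β = (|D| β' - γ(β') + β (Λ - |D|)) Λ⁻¹` with `β = σ(β')`
    have hle : -(n : ℝ) - 1 ≤ -n := by linarith
    have h1 := (((hM.mapsSob (s := -(n : ℝ)) rfl).mul (ih (σ.symm β))).sub
      ((ih (γ (σ.symm β))).mono h le_rfl hle)).add
      (((ih β).mul (hR.mapsSob (sub_zero (-(n : ℝ))))).mono h le_rfl hle)
    rw [hγ.absOp_mul_restrict h hD, LinearEquiv.apply_symm_apply, add_sub_cancel_right, ← mul_add,
      add_sub_cancel] at h1
    have h2 := h1.mul (h.mapsSob_sobPow (z := -1) (s := -(n : ℝ) - 1) (t := -n) (by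
      rw [Complex.neg_re, Complex.one_re]; linarith))
    rw [mul_assoc, h.sobPow_mul_neg, mul_one] at h2
    rwa [Nat.cast_succ, neg_add']

lemma isOp_restrict (hD : IsDiag b D fun i => (x i : ℂ)) (β : B) :
    IsOp Δ 2 0 (hγ.restrict h β) := by
  intro s
  have hs := abs_le.mp (Nat.le_ceil |s|)
  refine MapsSob.between h (s₀ := -⌈|s|⌉₊) (s₁ := ⌈|s|⌉₊) ?_ ?_ hs.1 hs.2
  · rw [sub_zero]
    exact hγ.mapsSob_neg_natCast h hD _ β
  · rw [sub_zero]
    exact hγ.mapsSob_natCast h hD _ β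

lemma isOp_comm (hD : IsDiag b D fun i => (x i : ℂ)) (β : B) :
    IsOp Δ 2 0 (sobPow Δ 1 * hγ.restrict h β - hγ.restrict h (σ β) * sobPow Δ 1) := by
  have hR := isOp_sobPow_sub_absOp hD h
  have h1 := hR.mul (hγ.isOp_restrict h hD β)
  have h2 := (hγ.isOp_restrict h hD (σ β)).mul hR
  rw [zero_add] at h1 h2
  have h3 := ((hγ.isOp_restrict h hD (γ β)).add h1).sub h2
  rw [sub_mul, mul_sub, hγ.absOp_mul_restrict h hD] at h3
  convert h3 using 1
  abel

end AbsCommutes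

end Regular

/-! ### Twistings of `Op` from regularity and from differential operators -/

section Twistings

variable {A H : Type*} [Ring A] [StarRing A] [Algebra ℂ A] [StarModule ℂ A]
  [NormedAddCommGroup H] [InnerProductSpace ℂ H] [CompleteSpace H] {ι : Type*}
  {b : HilbertBasis ι ℂ H} {x : ι → ℝ} {S : TwistedSpectralTriple A H}

/-- Regularity yields a twisting of `Op`, extended from the algebra `B` restricted to `H^∞`. -/
theorem TwistedSpectralTriple.IsRegular.exists_opTwisting (hS : S.IsRegular)
    (hD : IsDiag b S.D fun i => (x i : ℂ)) (h : LapDiag b S.lap fun i => x i ^ 2 + 1) :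
    Nonempty (OpTwisting S h) := by
  obtain ⟨B, σ, hA, hcomm, habs⟩ := hS
  have hdiag := isDiag_absOp hD
  choose c hcB hdom hc using habs
  have hγ : AbsCommutes b x σ fun β => ⟨c β, hcB β⟩ := by
    intro β v w hvw i
    have hv : v ∈ (absOp S.D).domain := hdiag.domain_iff.mpr ⟨w, hvw⟩
    have hv' : v ∈ (twComm (absOp S.D) (β : H →L[ℂ] H) (σ β : H →L[ℂ] H)).domain :=
      (hdom β).symm ▸ hv
    have hw : absOp S.D ⟨v, hv⟩ = w :=
      ext_coord b fun j => (hdiag.apply ⟨v, hv⟩ j).trans (hvw j).symm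
    have h1 : absOp S.D ⟨(β : H →L[ℂ] H) v, hv'.2⟩ -
        (σ β : H →L[ℂ] H) (absOp S.D ⟨v, hv⟩) = c β v := hc β ⟨v, hv'⟩
    rw [hw, sub_eq_iff_eq_add'] at h1
    change ⟪b i, (σ β : H →L[ℂ] H) w + c β v⟫_ℂ = _
    rw [← h1]
    exact hdiag.apply ⟨(β : H →L[ℂ] H) v, hv'.2⟩ i
  obtain ⟨τ, hτ, hconj⟩ := h.exists_twisting (hγ.restrict h) (hγ.restrict_injective h) σ
    (hγ.isOp_restrict h hD) (hγ.isOp_comm h hD)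
  refine ⟨⟨τ, hconj, fun a => ?_, fun a T hT => ?_⟩⟩
  · obtain ⟨β, hβ, hβσ⟩ := hA a
    refine ⟨⟨hγ.restrict h β, 0, hγ.isOp_restrict h hD β⟩, hγ.isOp_restrict h hD β, ?_, ?_⟩
    · rw [← hβ]
      exact hγ.restricts_restrict h β
    · rw [← hβσ, hτ]
      exact hγ.restricts_restrict h (σ β)
  · exact ⟨_, hγ.isOp_restrict h hD ⟨T, hcomm a T hT⟩, hγ.restricts_restrict h _⟩

/-- The twisting of an algebra of differential operators, restricted to `𝓓^m`. -/
def TwistedDOAlgebra.filEquiv (𝓓 : TwistedDOAlgebra S.lap 2) (m : ℕ) :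
    𝓓.fil m ≃ₗ[ℂ] 𝓓.fil m where
  toFun := fun X => ⟨𝓓.θ ⟨X, 𝓓.fil_le m X.2⟩, (𝓓.θ_fil m _).mpr X.2⟩
  invFun := fun X => ⟨𝓓.θ.symm ⟨X, 𝓓.fil_le m X.2⟩, (𝓓.θ_fil m _).mp (by
    rw [LinearEquiv.apply_symm_apply]
    exact X.2)⟩
  map_add' := fun X Y => Subtype.ext (congrArg (fun T : 𝓓.carrier => (T : SmoothEnd S.lap))
    (map_add 𝓓.θ ⟨(X : SmoothEnd S.lap), 𝓓.fil_le m X.2⟩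
      ⟨(Y : SmoothEnd S.lap), 𝓓.fil_le m Y.2⟩))
  map_smul' := fun c X => Subtype.ext (congrArg (fun T : 𝓓.carrier => (T : SmoothEnd S.lap))
    (map_smul 𝓓.θ c ⟨(X : SmoothEnd S.lap), 𝓓.fil_le m X.2⟩))
  left_inv := fun X => Subtype.ext (congrArg (fun T : 𝓓.carrier => (T : SmoothEnd S.lap))
    (𝓓.θ.symm_apply_apply ⟨(X : SmoothEnd S.lap), 𝓓.fil_le m X.2⟩))
  right_inv := fun X => Subtype.ext (congrArg (fun T : 𝓓.carrier => (T : SmoothEnd S.lap))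
    (𝓓.θ.apply_symm_apply ⟨(X : SmoothEnd S.lap), 𝓓.fil_le m X.2⟩))

/-- A compatible twisted algebra of differential operators whose twisting is diagonalizable with
positive spectrum yields a twisting of `Op`, extended from `𝓓^0`. -/
theorem TwistedDOAlgebra.exists_opTwisting (𝓓 : TwistedDOAlgebra S.lap 2) (hA : 𝓓.Compatible)
    (hcomm : 𝓓.ContainsComm) (hdiag : 𝓓.Diagonalizable) (hpos : 𝓓.PositiveSpectrum)
    {lam : ι → ℝ} (h : LapDiag b S.lap lam) : Nonempty (OpTwisting S h) := by
  have hop : ∀ X ∈ 𝓓.fil 0, IsOp S.lap 2 0 X := fun X hX => by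
    have := 𝓓.isOp_of_mem_fil h hX
    rwa [Nat.cast_zero] at this
  obtain ⟨τ, hτ, hconj⟩ := h.exists_twisting (W := 𝓓.fil 0) (𝓓.fil 0).subtype
    Subtype.val_injective
    (𝓓.filEquiv 0) (fun X => hop _ X.2)
    (fun X => by
      have := 𝓓.isOp_twisted_comm h hdiag.submodule_iSup_eq_top hpos
        (X := ⟨X, 𝓓.fil_le 0 X.2⟩) X.2
      rwa [Nat.cast_zero] at this)
  refine ⟨⟨τ, hconj, fun a => ?_, fun a T hT => ?_⟩⟩
  · obtain ⟨X, hX, hXa, hXθ⟩ := hA a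
    refine ⟨⟨X, 0, hop _ hX⟩, hop _ hX, hXa, fun v => ?_⟩
    rw [← hXθ v]
    exact congrArg (fun T : SmoothEnd S.lap => (T v : H)) (hτ ⟨X, hX⟩)
  · obtain ⟨X, hX, hXT⟩ := hcomm a T hT
    exact ⟨X, hop X hX, hXT⟩

end Twistings

end TwistedNCG

end

theorem mainTheorem3 {A H : Type*} [Ring A] [StarRing A] [Algebra ℂ A] [StarModule ℂ A]
    [NormedAddCommGroup H] [InnerProductSpace ℂ H] [CompleteSpace H]
    (S : TwistedSpectralTriple A H) :
    ((∃ 𝓓 : TwistedDOAlgebra S.lap 2, 𝓓.Compatible ∧ 𝓓.ContainsComm ∧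
        𝓓.Diagonalizable ∧ 𝓓.PositiveSpectrum) →
      S.IsRegular ∧ ∃ Ψ : TwistedPsiDOAlgebra S.lap 2, Ψ.Compatible) ∧
    (S.IsRegular →
      ∃ 𝓓 : TwistedDOAlgebra S.lap 2, 𝓓.Compatible ∧ 𝓓.ContainsComm) := by
  obtain ⟨κ, b, x, hD⟩ := exists_hilbertBasis_isDiag S.selfAdjoint S.compactResolvent
  have h := S.lapDiag hD
  constructor
  · rintro ⟨𝓓, hA, hcomm, hdiag, hpos⟩
    obtain ⟨Θ⟩ := 𝓓.exists_opTwisting hA hcomm hdiag hpos h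
    exact ⟨Θ.isRegular hD, OpTwisting.psiDO h, Θ.psiDO_compatible⟩
  · intro hS
    obtain ⟨Θ⟩ := hS.exists_opTwisting hD h
    exact ⟨Θ.doAlgebra, Θ.doAlgebra_compatible, Θ.doAlgebra_containsComm⟩
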